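/- **Setting.** Let $X$ be a measurable space, $\mathcal Z=X\times\{0,1\}$, and $\mathcal H$ a class of measurable concepts $h:X\to\{0,1\}$. Assume (standard measurability convention) that $\mathcal H$ has a countable pointwise dense subclass $\mathcal H_0\subseteq\mathcal H$, i.e. for every $h\in\mathcal H$ and every finite $s\subseteq X$ some $h_0\in\mathcal H_0$ agrees with $h$ on $s$. The VC dimension of $\mathcal H$ is the largest size of a finite set all of whose labellings are induced by $\mathcal H$. A *learner* $\mathcal A_n$ consists of a measurable parameter space $\Theta$, a jointly measurable map $(\theta,x)\mapsto h_\theta(x)\in\{0,1\}$, and a Markov kernel $\mathcal A_n$ from $\mathcal Z^n$ to $\Theta$. A probability measure $\mathcal D$ on $\mathcal Z$ is *realizable* by $\mathcal H$ if some $h\in\mathcal H$ satisfies $h(x)=y$ for $\mathcal D$-almost every $(x,y)$. Let $$R(\mathcal A_n)=\sup_{\mathcal D\text{ realizable by }\mathcal H}\ \mathbb E_{S\sim\mathcal D^{\otimes n},\,\hat\theta\sim\mathcal A_n(S)}\Big[\mathcal D\{(x,y):h_{\hat\theta}(x)\ne y\}\Big].$$ The learner is *sample-optimal up to a factor $C$*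 if $R(\mathcal A_n)\le C\inf_{\mathcal A'_n}R(\mathcal A'_n)$, the infimum being over all learners with $n$ samples. A learner is *$(\xi,m)$-traceable*, for $\xi\in(0,1)$ and $m\in\mathbb N$, if there are a measurable $\varphi:\Theta\times\mathcal Z\to\mathbb R$, an arbitrary (not necessarily realizable) probability measure $\mathcal D$ on $\mathcal Z$ and $\lambda\in\mathbb R$ such that for $(Z_0,\dots,Z_n)\sim\mathcal D^{\otimes(n+1)}$ and $\hat\theta\sim\mathcal A_n(Z_1,\dots,Z_n)$ we have $\mathbb P(\varphi(\hat\theta,Z_0)\ge\lambda)\le\xi$ and $\mathbb E\,|\{i\in\{1,\dots,n\}:\varphi(\hat\theta,Z_i)\ge\lambda\}|\ge m$. **Theorem.** There is a universal constant $C>0$ such that for all integers $n\ge2$ and all $\xi\in(0,1/10)$: 1. For every $X$ and every class $\mathcal H$ as above with finite VC dimension $d_{\mathsf{vc}}$ there is a learner $\mathcal A_n$ that is sample-optimal for $\mathcal H$ up to the factor $C$ and such that, for every $m\in\mathbb N$, if $\mathcal A_n$ is $\big(\tfrac{\xi}{n\log n},m\big)$-traceable, then $m\le C\,d_{\mathsf{vc}}\log^2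 n$. 2. If $\mathcal H=\{x\mapsto\mathbf 1[x\ge a]:a\in\mathbb R\}$ is the class of thresholds on $\mathbb R$, there is a learner $\mathcal A_n$ that is sample-optimal for $\mathcal H$ up to the factor $C$ and such that, for every $m\in\mathbb N$, if $\mathcal A_n$ is $\big(\tfrac{\xi}{n\log n},m\big)$-traceable, then $m\le C$. -/

import Mathlib

open MeasureTheory ProbabilityTheory
open scoped ENNReal

universe u

section VC

variable {X : Type u}

/-- The finite set `s` is shattered by the concept class `H`: every labelling of `s` is the
restriction of a concept of `H`. -/
def Shatters (H : Set (X → Bool)) (s : Finset X) : Prop :=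
  ∀ f : X → Bool, ∃ h ∈ H, ∀ x ∈ s, h x = f x

/-- `H` has (finite) VC dimension `d`: the largest size of a finite set shattered by `H` is `d`.
(In particular `H` is nonempty, as otherwise not even the empty set is shattered.) -/
def HasVCDim (H : Set (X → Bool)) (d : ℕ) : Prop :=
  IsGreatest {k : ℕ | ∃ s : Finset X, s.card = k ∧ Shatters H s} d

/-- The measurability convention for concept classes: all concepts are measurable, and `H` has a
countable subclass that is pointwise dense, i.e. on every finite set of points every concept of
`H` agrees with a concept of the countable subclass. Every class of measurable concepts that is
countable, and every class over a countable domain with measurable points, is of this kind. -/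
structure IsMeasurableClass [MeasurableSpace X] (H : Set (X → Bool)) : Prop where
  measurable : ∀ h ∈ H, Measurable h
  exists_countable_dense : ∃ H₀ : Set (X → Bool), H₀ ⊆ H ∧ H₀.Countable ∧
    ∀ h ∈ H, ∀ s : Finset X, ∃ h₀ ∈ H₀, ∀ x ∈ s, h₀ x = h x

end VC

/-- The class of thresholds on the real line, `x ↦ 1[x ≥ a]` for `a ∈ ℝ`. -/
noncomputable def thresholds : Set (ℝ → Bool) :=
  Set.range fun a x : ℝ => decide (a ≤ x)

/-- A (randomized, possibly improper) learning algorithm for binary classification over the domain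
`X` with `n` labelled samples: a Markov kernel from samples in `(X × {0,1})ⁿ` to a measurable
parameter space `Θ`, each parameter `θ` standing for the classifier `predict θ`. -/
structure Learner (X : Type u) [MeasurableSpace X] (n : ℕ) where
  /-- the parameter space -/
  Θ : Type u
  [instMeasurableSpace : MeasurableSpace Θ]
  /-- the classifier given by a parameter -/
  predict : Θ → X → Bool
  measurable_predict : Measurable (Function.uncurry predict)
  /-- the law of the output, given the training sample -/
  kernel : Kernel (Fin n → X × Bool) Θ
  [isMarkovKernel : IsMarkovKernel kernel]

attribute [instance] Learner.instMeasurableSpace Learner.isMarkovKernel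

section Risk

variable {X : Type u} [MeasurableSpace X]

/-- The data distribution `D` is realizable by `H`: the labels are almost surely those of some
concept of `H`. -/
def Realizable (H : Set (X → Bool)) (D : Measure (X × Bool)) : Prop :=
  ∃ h ∈ H, ∀ᵐ z ∂D, h z.1 = z.2

/-- The expected misclassification error of the learner, trained on `n` i.i.d. samples of `D`. -/
noncomputable def Learner.expectedRisk {n : ℕ} (A : Learner X n) (D : Measure (X × Bool)) :
    ℝ≥0∞ :=
  ∫⁻ S, ∫⁻ θ, D {z | A.predict θ z.1 ≠ z.2} ∂(A.kernel S) ∂(Measure.pi fun _ : Fin n => D)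

/-- The supremum of the expected error over all distributions realizable by `H`. -/
noncomputable def Learner.worstRisk {n : ℕ} (A : Learner X n) (H : Set (X → Bool)) : ℝ≥0∞ :=
  ⨆ (D : Measure (X × Bool)) (_ : IsProbabilityMeasure D) (_ : Realizable H D), A.expectedRisk D

/-- The minimax expected error of learning `H` with `n` samples in the realizable setting. -/
noncomputable def minimaxRisk (H : Set (X → Bool)) (n : ℕ) : ℝ≥0∞ :=
  ⨅ A : Learner X n, A.worstRisk H

/-- The learner is sample-optimal for `H` up to the factor `C`: with its `n` samples it attains the
minimax expected error up to the factor `C`. -/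
def Learner.IsSampleOptimal {n : ℕ} (A : Learner X n) (H : Set (X → Bool)) (C : ℝ) : Prop :=
  A.worstRisk H ≤ ENNReal.ofReal C * minimaxRisk H n

/-- The joint law of `((Z₀, Z₁, …, Zₙ), θ)`, where `Z₀, …, Zₙ` are i.i.d. from `D` and `θ` is the
output of the learner on the training sample `(Z₁, …, Zₙ)`. -/
noncomputable def Learner.tracingLaw {n : ℕ} (A : Learner X n) (D : Measure (X × Bool)) :
    Measure ((Fin (n + 1) → X × Bool) × A.Θ) :=
  (Measure.pi fun _ : Fin (n + 1) => D) ⊗ₘ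
    (A.kernel.comap (fun z (i : Fin n) => z i.succ)
      (measurable_pi_lambda _ fun i => measurable_pi_apply i.succ))

/-- `(ξ, m)`-traceability: there are a tracer `(φ, D)` and a threshold `t` such that the held-out
point `Z₀` is declared IN with probability at most `ξ` (soundness), while the expected number of
training points that are declared IN is at least `m` (recall). -/
def Learner.IsTraceable {n : ℕ} (A : Learner X n) (ξ : ℝ) (m : ℕ) : Prop :=
  ∃ (φ : A.Θ → X × Bool → ℝ) (D : Measure (X × Bool)) (t : ℝ),
    Measurable (Function.uncurry φ) ∧ IsProbabilityMeasure D ∧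
    A.tracingLaw D {ω | t ≤ φ ω.2 (ω.1 0)} ≤ ENNReal.ofReal ξ ∧
    (m : ℝ≥0∞) ≤
      ∫⁻ ω, (((Finset.univ.filter fun i : Fin n => t ≤ φ ω.2 (ω.1 i.succ)).card : ℕ) : ℝ≥0∞)
        ∂(A.tracingLaw D)

end Risk

/-! Part 1 uses the majority vote of three empirical risk minimizers, each trained on its own third
of the sample. Each minimizer returns the first consistent concept in one fixed enumeration of the
countable dense subclass. Being first matters for tracing, being consistent for the risk.

Tracing. Draw `n` independent pairs, train on one point of each pair and hold out the other; random
signs decide which. Two first consistent indices that induce the same labels on all `2n` points are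
equal, so by Sauer-Shelah each block has at most `(2n+1)^d` possible outputs whatever the signs, and
the three together at most `(2n+1)^(3d)`. For a fixed output, marked training points minus twice the
marked held-out points has exponential moment at most 1 per pair, after averaging over the sign. A
union bound over the outputs (`sum_signedScore_le`, `symmetrization`) gives recall at most `2nξ' +
O(d log n)`, where `ξ'` bounds the false-positive rate. This holds for every distribution,
realizable or not, and is stronger than the required `d log² n`.

Risk. The majority errs only where two independent minimizers err, so its risk is controlled by `∫
P²`, where `P z` is the probability that a minimizer errs at `z`. The same symmetrization, with
training and held-out points exchanged and counting only errors inside a region `R`, involves only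
the points that fall in `R` (`error_in_region_le`). Applied to `R = {P > s}` it yields `D R ≲ (d/k)
log(1/s) / s` for block size `k`; summing over dyadic levels makes `∫ P²` of order `d/k` without a
logarithm (`lintegral_error_sq_le`). A lower bound of order `min(d/n, 1)` comes from rare points
with random labels (`minimaxRisk_ge`). It fails only for classes in which one value determines the
concept, and there the learner has zero risk.

Part 2 uses the threshold at the least positive example. Exchanging the held-out point with a
training point changes the output only if one of the two is the strict minimum, which has
probability at most `2/(n+1)` by exchangeability. So a training point is marked with probability at
most `ξ' + 2/(n+1)`, and the recall is at most `nξ' + 2`. -/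

/-! ### Sauer-Shelah counting and a maximal inequality for random signs. -/

section Combinatorics

variable {X : Type u}

/-- The **Sauer-Shelah lemma** for the restriction of a concept class to a finite family of
points. -/
theorem HasVCDim.ncard_restrict_le {ι : Type*} [Fintype ι] {H : Set (X → Bool)} {d : ℕ}
    (hd : HasVCDim H d) (x : ι → X) :
    ((fun (h : X → Bool) (i : ι) => h (x i)) '' H).ncard ≤
      ∑ i ∈ Finset.range (d + 1), (Fintype.card ι).choose i := by
  classical
  set 𝒜 : Finset (Finset ι) := Finset.univ.filter fun t =>
    ∃ h ∈ H, t = Finset.univ.filter fun i => h (x i) = true with h𝒜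
  have h1 : ((fun (h : X → Bool) (i : ι) => h (x i)) '' H).ncard ≤ 𝒜.card := by
    rw [← Set.ncard_coe_finset]
    refine Set.ncard_le_ncard_of_injOn
      (fun f : ι → Bool => Finset.univ.filter fun i => f i = true) ?_ ?_ (Finset.finite_toSet _)
    · rintro _ ⟨h, hh, rfl⟩
      simp only [h𝒜, Finset.coe_filter, Finset.mem_univ, true_and]
      exact ⟨h, hh, rfl⟩
    · intro f _ g _ hfg
      funext i
      have := Finset.ext_iff.1 hfg i
      simp only [Finset.mem_filter, Finset.mem_univ, true_and] at this
      exact Bool.eq_iff_iff.2 this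
  have h2 : 𝒜.vcDim ≤ d := by
    refine Finset.sup_le fun T hT => ?_
    rw [Finset.mem_shatterer] at hT
    have hmem : ∀ t ⊆ T, ∃ h ∈ H, ∀ i ∈ T, h (x i) = true ↔ i ∈ t := by
      intro t ht
      obtain ⟨u, hu, hut⟩ := hT ht
      simp only [h𝒜, Finset.mem_filter, Finset.mem_univ, true_and] at hu
      obtain ⟨h, hh, rfl⟩ := hu
      refine ⟨h, hh, fun i hi => ?_⟩
      rw [← hut]
      simp [hi]
    -- Shattering is of indices; the pattern selecting only `i` shows that distinct indices of `T`
    -- carry distinct points.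
    have hinj : Set.InjOn x T := by
      intro i hi j hj hij
      obtain ⟨h, _, hh⟩ := hmem {i} (by simpa using hi)
      have h1 := (hh i hi).2 (Finset.mem_singleton_self i)
      rw [hij] at h1
      exact (Finset.mem_singleton.1 ((hh j hj).1 h1)).symm
    refine hd.2 ⟨T.image x, Finset.card_image_of_injOn hinj, fun f => ?_⟩
    obtain ⟨h, hh, hT'⟩ := hmem (T.filter fun i => f (x i) = true) (Finset.filter_subset _ _)
    refine ⟨h, hh, fun y hy => ?_⟩
    obtain ⟨i, hi, rfl⟩ := Finset.mem_image.1 hy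
    have := hT' i hi
    simp only [Finset.mem_filter, hi, true_and] at this
    exact Bool.eq_iff_iff.2 this
  refine h1.trans ((Finset.card_le_card_shatterer 𝒜).trans
    ((Finset.card_shatterer_le_sum_vcDim).trans ?_))
  refine Finset.sum_le_sum_of_subset fun k hk => ?_
  rw [Finset.mem_Iic] at hk
  exact Finset.mem_range.2 (by omega)

theorem sum_range_choose_le_add_one_pow (N d : ℕ) :
    ∑ i ∈ Finset.range (d + 1), N.choose i ≤ (N + 1) ^ d := by
  rw [add_pow]
  refine Finset.sum_le_sum fun i hi => ?_
  have h1 : N.choose i ≤ N ^ i := Nat.choose_le_pow N i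
  have h2 : 1 ≤ d.choose i := Nat.choose_pos (by simpa [Nat.lt_succ_iff] using hi)
  simpa using Nat.mul_le_mul h1 h2

/-- Compare with the binomial expansion of `(1 + x)^N`, using `x^d ≤ x^i` for `i ≤ d`. A bound
linear in `N` with free `x` can be integrated over a random `N` directly. -/
theorem log_sum_range_choose_le (N d : ℕ) {x : ℝ} (hx : 0 < x) (hx1 : x ≤ 1) :
    Real.log (∑ i ∈ Finset.range (d + 1), (N.choose i : ℝ)) ≤ d * Real.log (1 / x) + N * x := by
  have hpos : (0 : ℝ) < ∑ i ∈ Finset.range (d + 1), (N.choose i : ℝ) := by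
    refine Finset.sum_pos' (fun i _ => by positivity) ⟨0, by simp, by simp⟩
  have hle : x ^ d * ∑ i ∈ Finset.range (d + 1), (N.choose i : ℝ) ≤ (1 + x) ^ N := by
    have h1 : (1 + x) ^ N = ∑ i ∈ Finset.range (N + 1), x ^ i * (N.choose i : ℝ) := by
      rw [add_comm, add_pow]; simp
    have h2 : ∑ i ∈ Finset.range (N + 1), x ^ i * (N.choose i : ℝ) =
        ∑ i ∈ Finset.range (N + d + 1), x ^ i * (N.choose i : ℝ) := by
      refine Finset.sum_subset (Finset.range_mono (by omega)) fun i _ hi => ?_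
      rw [Nat.choose_eq_zero_of_lt (by simpa using hi)]; simp
    rw [h1, h2, Finset.mul_sum]
    calc ∑ i ∈ Finset.range (d + 1), x ^ d * (N.choose i : ℝ)
        ≤ ∑ i ∈ Finset.range (d + 1), x ^ i * (N.choose i : ℝ) := by
          refine Finset.sum_le_sum fun i hi => ?_
          gcongr ?_ * _
          exact pow_le_pow_of_le_one hx.le hx1 (by simpa [Nat.lt_succ_iff] using hi)
      _ ≤ _ := Finset.sum_le_sum_of_subset_of_nonneg (Finset.range_mono (by omega))
          fun i _ _ => by positivity
  have h3 := Real.log_le_log (by positivity) hle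
  rw [Real.log_mul (by positivity) hpos.ne', Real.log_pow, Real.log_pow] at h3
  have h4 : Real.log (1 + x) ≤ x := by
    have := Real.log_le_sub_one_of_pos (show 0 < 1 + x by linarith); linarith
  have h5 : (N : ℝ) * Real.log (1 + x) ≤ N * x := by gcongr
  rw [one_div, Real.log_inv]
  linarith

/-- The signed score of a pair of indicators: the second entry counts `-2` times; the sign bit
exchanges the two entries. -/
def signedScore (b : Bool) (v : Bool × Bool) : ℝ :=
  if b then (if v.2 then 1 else 0) - 2 * (if v.1 then 1 else 0)
  else (if v.1 then 1 else 0) - 2 * (if v.2 then 1 else 0)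

/-- The only tight cases have sum at most 2: `1 + 1` for no indicator, `3/2 + 4/9` for one; two give
`4/3`. Doubling the penalty leaves room for a positive exponent, hence a bound without a square-root
deviation. -/
theorem exp_signedScore_add_le (v : Bool × Bool) :
    Real.exp (Real.log (3 / 2) * signedScore true v) +
      Real.exp (Real.log (3 / 2) * signedScore false v) ≤ 2 := by
  have e1 : Real.exp (Real.log (3 / 2)) = 3 / 2 := Real.exp_log (by norm_num)
  have e2 : Real.exp (-(Real.log (3 / 2) * 2)) = 4 / 9 := by
    rw [mul_two, Real.exp_neg, Real.exp_add, e1]; norm_num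
  have e3 : Real.exp (-Real.log (3 / 2)) = 2 / 3 := by
    rw [Real.exp_neg, e1]; norm_num
  rcases v with ⟨a, b⟩
  cases a <;> cases b <;> norm_num [signedScore, e1, e2, e3]

/-- Maximal inequality for random signs: if for each sign vector a pattern from a set of `K`
patterns is scored, the average total score is at most `log K / log (3 / 2)`. -/
theorem sum_signedScore_le {ι : Type*} [Fintype ι] [DecidableEq ι] (V : Finset (ι → Bool × Bool))
    (v : (ι → Bool) → ι → Bool × Bool) (hv : ∀ σ, v σ ∈ V) :
    Real.log (3 / 2) * ∑ σ, ∑ i, signedScore (σ i) (v σ i) ≤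
      2 ^ Fintype.card ι * Real.log V.card := by
  set c := Real.log (3 / 2)
  have hK : (0 : ℝ) < V.card := by
    exact_mod_cast Finset.card_pos.2 ⟨v (fun _ => true), hv _⟩
  have hfix : ∀ w : ι → Bool × Bool,
      ∑ σ : ι → Bool, Real.exp (c * ∑ i, signedScore (σ i) (w i)) ≤ 2 ^ Fintype.card ι := by
    intro w
    calc ∑ σ : ι → Bool, Real.exp (c * ∑ i, signedScore (σ i) (w i))
        = ∑ σ : ι → Bool, ∏ i, Real.exp (c * signedScore (σ i) (w i)) := by
          simp_rw [Finset.mul_sum, Real.exp_sum]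
      _ = ∏ i, ∑ b : Bool, Real.exp (c * signedScore b (w i)) :=
          (Fintype.prod_sum fun i b => Real.exp (c * signedScore b (w i))).symm
      _ ≤ ∏ _i : ι, (2 : ℝ) := by
          refine Finset.prod_le_prod (fun i _ => by positivity) fun i _ => ?_
          simpa using exp_signedScore_add_le (w i)
      _ = _ := by simp
  have htot : ∑ σ : ι → Bool, Real.exp (c * ∑ i, signedScore (σ i) (v σ i)) ≤
      V.card * 2 ^ Fintype.card ι := by
    calc ∑ σ : ι → Bool, Real.exp (c * ∑ i, signedScore (σ i) (v σ i))
        ≤ ∑ σ : ι → Bool, ∑ w ∈ V, Real.exp (c * ∑ i, signedScore (σ i) (w i)) :=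
          Finset.sum_le_sum fun σ _ => Finset.single_le_sum
            (f := fun w : ι → Bool × Bool => Real.exp (c * ∑ i, signedScore (σ i) (w i)))
            (fun w _ => by positivity) (hv σ)
      _ = ∑ w ∈ V, ∑ σ : ι → Bool, Real.exp (c * ∑ i, signedScore (σ i) (w i)) :=
          Finset.sum_comm
      _ ≤ ∑ _w ∈ V, (2 : ℝ) ^ Fintype.card ι := Finset.sum_le_sum fun w _ => hfix w
      _ = _ := by simp
  -- The inequality `log t ≤ t - 1`, with `t` the exponential divided by the number of patterns,
  -- plays the role of Jensen's inequality.
  have hpt : ∀ σ : ι → Bool, c * ∑ i, signedScore (σ i) (v σ i) ≤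
      Real.log V.card + (Real.exp (c * ∑ i, signedScore (σ i) (v σ i)) / V.card - 1) := by
    intro σ
    have := Real.log_le_sub_one_of_pos
      (show 0 < Real.exp (c * ∑ i, signedScore (σ i) (v σ i)) / V.card by positivity)
    rw [Real.log_div (Real.exp_pos _).ne' hK.ne', Real.log_exp] at this
    linarith
  rw [Finset.mul_sum]
  refine (Finset.sum_le_sum fun σ _ => hpt σ).trans ?_
  rw [Finset.sum_add_distrib, Finset.sum_sub_distrib, ← Finset.sum_div]
  have : (∑ σ : ι → Bool, Real.exp (c * ∑ i, signedScore (σ i) (v σ i))) / V.card ≤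
      2 ^ Fintype.card ι := by
    rw [div_le_iff₀ hK]; linarith
  simp only [Finset.sum_const, Finset.card_univ, Fintype.card_fun, Fintype.card_bool,
    nsmul_eq_mul]
  push_cast
  linarith

end Combinatorics

/-! ### Symmetrization over random swaps of paired samples. -/

section Symmetrization

variable {Z Θ ι : Type*}

/-- Exchange the entries of the pairs whose sign bit is set. -/
def swapBy (σ : ι → Bool) (ω : ι → Z × Z) : ι → Z × Z :=
  fun i => if σ i then (ω i).swap else ω i

open Classical in
/-- The indicators of the section of `Q` at `θ` on a family of pairs. -/
noncomputable def pairPattern (Q : Set (Θ × Z)) (ω : ι → Z × Z) (θ : Θ) : ι → Bool × Bool :=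
  fun i => (decide ((θ, (ω i).1) ∈ Q), decide ((θ, (ω i).2) ∈ Q))

theorem pairPattern_swapBy (Q : Set (Θ × Z)) (ω : ι → Z × Z) (θ : Θ) (σ : ι → Bool) (c : Bool)
    (i : ι) : signedScore c (pairPattern Q (swapBy σ ω) θ i) =
      signedScore (xor c (σ i)) (pairPattern Q ω θ i) := by
  by_cases h : σ i = true
  · have hs : swapBy σ ω i = (ω i).swap := by simp [swapBy, h]
    have hp : pairPattern Q (swapBy σ ω) θ i = (pairPattern Q ω θ i).swap := by
      unfold pairPattern; rw [hs]; rfl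
    rw [hp, h]
    cases c <;> simp [signedScore]
  · have hs : swapBy σ ω i = ω i := by simp [swapBy, h]
    have hp : pairPattern Q (swapBy σ ω) θ i = pairPattern Q ω θ i := by
      unfold pairPattern; rw [hs]
    rw [hp, Bool.eq_false_of_not_eq_true h, Bool.xor_false]

theorem pairPattern_score_eq_indicator (Q : Set (Θ × Z)) (a : (ι → Z) → Θ) (i : ι) (c : Bool) :
    (fun ω : ι → Z × Z => signedScore c (pairPattern Q ω (a fun i => (ω i).1) i)) =
      fun ω => (if c then -2 else 1) *
          {ω : ι → Z × Z | (a fun i => (ω i).1, (ω i).1) ∈ Q}.indicator (fun _ => (1 : ℝ)) ω +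
        (if c then 1 else -2) *
          {ω : ι → Z × Z | (a fun i => (ω i).1, (ω i).2) ∈ Q}.indicator (fun _ => (1 : ℝ)) ω := by
  classical
  funext ω
  by_cases h1 : (a fun i => (ω i).1, (ω i).1) ∈ Q <;>
    by_cases h2 : (a fun i => (ω i).1, (ω i).2) ∈ Q <;>
    cases c <;> norm_num [signedScore, pairPattern, Set.indicator_apply, h1, h2]

variable [MeasurableSpace Z] [MeasurableSpace Θ] [Fintype ι]

theorem measurePreserving_swapBy (D : Measure Z) [IsProbabilityMeasure D] (σ : ι → Bool) :
    MeasurePreserving (swapBy σ) (Measure.pi fun _ : ι => D.prod D)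
      (Measure.pi fun _ : ι => D.prod D) := by
  refine measurePreserving_pi (f := fun i (z : Z × Z) => if σ i then z.swap else z) _ _ fun i => ?_
  by_cases h : σ i = true
  · simpa [h] using Measure.measurePreserving_swap (μ := D) (ν := D)
  · simp only [h]
    exact MeasurePreserving.id (D.prod D)

theorem measurePreserving_fst_pi (D : Measure Z) [IsProbabilityMeasure D] :
    MeasurePreserving (fun (ω : ι → Z × Z) i => (ω i).1) (Measure.pi fun _ : ι => D.prod D)
      (Measure.pi fun _ : ι => D) :=
  measurePreserving_pi _ _ fun _ => measurePreserving_fst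

theorem measurePreserving_fst_pi_snd (D : Measure Z) [IsProbabilityMeasure D] (i : ι) :
    MeasurePreserving (fun ω : ι → Z × Z => ((fun j => (ω j).1), (ω i).2))
      (Measure.pi fun _ : ι => D.prod D) ((Measure.pi fun _ : ι => D).prod D) :=
  ((MeasurePreserving.id (Measure.pi fun _ : ι => D)).prod
    (measurePreserving_eval (fun _ : ι => D) i)).comp
    (measurePreserving_arrowProdEquivProdArrow Z Z ι (fun _ => D) fun _ => D)

/-- Symmetrization. A randomly split sample of pairs is scored by the training points (if `c` is
false) or by the held-out points (if `c` is true) that lie in the section of `Q` at the output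
`a S`, penalized by twice the other count. -/
theorem symmetrization (D : Measure Z) [IsProbabilityMeasure D] {a : (ι → Z) → Θ}
    (ha : Measurable a) {Q : Set (Θ × Z)} (hQ : MeasurableSet Q) {b : (ι → Z × Z) → ℝ}
    (hb : Integrable b (Measure.pi fun _ : ι => D.prod D))
    (hpat : ∀ ω, Real.log (Set.range fun σ : ι → Bool =>
      pairPattern Q ω (a fun i => (swapBy σ ω i).1)).ncard ≤ b ω) (c : Bool) :
    Real.log (3 / 2) * ((if c then -2 else 1) *
        ∑ i, (Measure.pi fun _ : ι => D).real {S | (a S, S i) ∈ Q} +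
      (if c then 1 else -2) * (Fintype.card ι *
        ((Measure.pi fun _ : ι => D).prod D).real {p | (a p.1, p.2) ∈ Q})) ≤
      ∫ ω, b ω ∂(Measure.pi fun _ : ι => D.prod D) := by
  classical
  set μ := Measure.pi fun _ : ι => D.prod D
  have hm1 : ∀ i, MeasurableSet {S : ι → Z | (a S, S i) ∈ Q} := fun i =>
    (ha.prodMk (measurable_pi_apply i)) hQ
  have hm2 : MeasurableSet {p : (ι → Z) × Z | (a p.1, p.2) ∈ Q} :=
    ((ha.comp measurable_fst).prodMk measurable_snd) hQ
  have hA : ∀ i, MeasurableSet {ω : ι → Z × Z | (a fun i => (ω i).1, (ω i).1) ∈ Q} := fun i =>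
    (measurePreserving_fst_pi D).measurable (hm1 i)
  have hB : ∀ i, MeasurableSet {ω : ι → Z × Z | (a fun i => (ω i).1, (ω i).2) ∈ Q} := fun i =>
    (measurePreserving_fst_pi_snd D i).measurable hm2
  have hAm : ∀ i, μ.real {ω : ι → Z × Z | (a fun i => (ω i).1, (ω i).1) ∈ Q} =
      (Measure.pi fun _ : ι => D).real {S | (a S, S i) ∈ Q} := fun i =>
    congrArg ENNReal.toReal
      ((measurePreserving_fst_pi D).measure_preimage (hm1 i).nullMeasurableSet)
  have hBm : ∀ i, μ.real {ω : ι → Z × Z | (a fun i => (ω i).1, (ω i).2) ∈ Q} =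
      ((Measure.pi fun _ : ι => D).prod D).real {p | (a p.1, p.2) ∈ Q} := fun i =>
    congrArg ENNReal.toReal
      ((measurePreserving_fst_pi_snd D i).measure_preimage hm2.nullMeasurableSet)
  have hiA : ∀ i, Integrable ({ω : ι → Z × Z | (a fun i => (ω i).1, (ω i).1) ∈ Q}.indicator
      fun _ => (1 : ℝ)) μ := fun i => (integrable_const 1).indicator (hA i)
  have hiB : ∀ i, Integrable ({ω : ι → Z × Z | (a fun i => (ω i).1, (ω i).2) ∈ Q}.indicator
      fun _ => (1 : ℝ)) μ := fun i => (integrable_const 1).indicator (hB i)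
  have hi : ∀ i, Integrable
      (fun ω : ι → Z × Z => signedScore c (pairPattern Q ω (a fun i => (ω i).1) i)) μ := fun i => by
    rw [pairPattern_score_eq_indicator]
    exact ((hiA i).const_mul _).add ((hiB i).const_mul _)
  set F : (ι → Z × Z) → ℝ := fun ω => ∑ i, signedScore c (pairPattern Q ω (a fun i => (ω i).1) i)
    with hF
  have hFi : Integrable F μ := integrable_finsetSum _ fun i _ => hi i
  have hFint : ∫ ω, F ω ∂μ = (if c then -2 else 1) *
        ∑ i, (Measure.pi fun _ : ι => D).real {S | (a S, S i) ∈ Q} +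
      (if c then 1 else -2) * (Fintype.card ι *
        ((Measure.pi fun _ : ι => D).prod D).real {p | (a p.1, p.2) ∈ Q}) := by
    rw [integral_finsetSum _ fun i _ => hi i]
    have : ∀ i, ∫ ω, signedScore c (pairPattern Q ω (a fun i => (ω i).1) i) ∂μ =
        (if c then -2 else 1) * (Measure.pi fun _ : ι => D).real {S | (a S, S i) ∈ Q} +
        (if c then 1 else -2) *
          ((Measure.pi fun _ : ι => D).prod D).real {p | (a p.1, p.2) ∈ Q} := fun i => by
      rw [pairPattern_score_eq_indicator,
        integral_add ((hiA i).const_mul _) ((hiB i).const_mul _), integral_const_mul,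
        integral_const_mul, integral_indicator_const _ (hA i), integral_indicator_const _ (hB i),
        hAm, hBm]
      simp
    simp_rw [this, Finset.sum_add_distrib, ← Finset.mul_sum]
    simp
  have hswap : ∀ σ : ι → Bool, ∫ ω, F (swapBy σ ω) ∂μ = ∫ ω, F ω ∂μ := fun σ => by
    have hmp : MeasurePreserving (swapBy σ) μ μ := measurePreserving_swapBy (ι := ι) D σ
    conv_rhs => rw [← hmp.map_eq]
    rw [integral_map hmp.measurable.aemeasurable]
    rw [hmp.map_eq]; exact hFi.aestronglyMeasurable
  have hpt : ∀ ω, Real.log (3 / 2) * ∑ σ : ι → Bool, F (swapBy σ ω) ≤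
      2 ^ Fintype.card ι * b ω := by
    intro ω
    set V := Set.range fun σ : ι → Bool => pairPattern Q ω (a fun i => (swapBy σ ω i).1) with hV
    have hVf : V.Finite := Set.finite_range _
    have hx : ∀ c : Bool, Function.Involutive fun (σ : ι → Bool) i => xor c (σ i) := fun c σ => by
      funext i; cases c <;> simp
    have h1 := sum_signedScore_le hVf.toFinset
      (fun σ => pairPattern Q ω (a fun i => (swapBy (fun i => xor c (σ i)) ω i).1))
      (fun σ => by rw [Set.Finite.mem_toFinset]; exact ⟨_, rfl⟩)
    -- Swapping the pair while keeping the output amounts to flipping the score's sign bit;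
    -- reindexing by `xor c` brings the score into the form of the maximal inequality.
    have h2 : ∑ σ : ι → Bool, F (swapBy σ ω) = ∑ σ : ι → Bool, ∑ i, signedScore (σ i)
        (pairPattern Q ω (a fun i => (swapBy (fun i => xor c (σ i)) ω i).1) i) := by
      rw [← Equiv.sum_comp (Function.Involutive.toPerm _ (hx c))]
      refine Finset.sum_congr rfl fun σ _ => ?_
      simp only [hF, Function.Involutive.coe_toPerm, pairPattern_swapBy]
      refine Finset.sum_congr rfl fun i _ => ?_
      cases c <;> simp
    rw [h2]
    refine h1.trans ?_
    rw [← Set.ncard_eq_toFinset_card _ hVf]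
    exact mul_le_mul_of_nonneg_left (hpat ω) (by positivity)
  have hsi : ∀ σ : ι → Bool, Integrable (fun ω => F (swapBy σ ω)) μ := fun σ =>
    (measurePreserving_swapBy (ι := ι) D σ).integrable_comp_of_integrable hFi
  have hfin := integral_mono (((integrable_finsetSum Finset.univ fun σ _ => hsi σ)).const_mul
    (Real.log (3 / 2))) (hb.const_mul _) hpt
  rw [integral_const_mul, integral_const_mul, integral_finsetSum _ fun σ _ => hsi σ] at hfin
  simp_rw [hswap] at hfin
  simp only [Finset.sum_const, Finset.card_univ, Fintype.card_fun, Fintype.card_bool,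
    nsmul_eq_mul] at hfin
  push_cast at hfin
  rw [← hFint]
  have h2 : (0 : ℝ) < 2 ^ Fintype.card ι := by positivity
  nlinarith

end Symmetrization

/-! ### Error of consistent learners inside a region. -/

section Regions

variable {X : Type u} {ι : Type*} [Fintype ι]

/-- The number of points of a family of pairs that lie in the region `R`. -/
noncomputable def pairCount (R : Set (X × Bool)) (ω : ι → (X × Bool) × (X × Bool)) : ℝ :=
  ∑ i, (R.indicator (fun _ => 1) (ω i).1 + R.indicator (fun _ => 1) (ω i).2)

/-- Outside `R` the pattern vanishes, so it is a function of the labels on the points lying in `R`;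
Sauer-Shelah is applied to those points only. -/
theorem log_ncard_pairPattern_le {H : Set (X → Bool)} {d : ℕ} (hd : HasVCDim H d)
    {g : ℕ → X → Bool} (hg : ∀ j, g j ∈ H) (R : Set (X × Bool))
    (ω : ι → (X × Bool) × (X × Bool)) (J : (ι → Bool) → ℕ) {x : ℝ} (hx : 0 < x) (hx1 : x ≤ 1) :
    Real.log (Set.range fun σ =>
        pairPattern {q : ℕ × (X × Bool) | q.2 ∈ R ∧ g q.1 q.2.1 ≠ q.2.2} ω (J σ)).ncard ≤
      d * Real.log (1 / x) + pairCount R ω * x := by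
  classical
  set pt : ι × Bool → X × Bool := fun p => if p.2 then (ω p.1).2 else (ω p.1).1 with hpt
  set P := {p : ι × Bool // pt p ∈ R}
  set Φ : (P → Bool) → ι → Bool × Bool := fun ℓ i =>
    (decide (∃ h : pt (i, false) ∈ R, ℓ ⟨(i, false), h⟩ ≠ (pt (i, false)).2),
      decide (∃ h : pt (i, true) ∈ R, ℓ ⟨(i, true), h⟩ ≠ (pt (i, true)).2))
  have hsub : (Set.range fun σ =>
      pairPattern {q : ℕ × (X × Bool) | q.2 ∈ R ∧ g q.1 q.2.1 ≠ q.2.2} ω (J σ)) ⊆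
      Φ '' ((fun (h : X → Bool) (p : P) => h (pt p.1).1) '' H) := by
    rintro _ ⟨σ, rfl⟩
    refine ⟨_, ⟨g (J σ), hg _, rfl⟩, ?_⟩
    funext i
    simp [Φ, pairPattern, hpt]
  have hcard : ((Fintype.card P : ℕ) : ℝ) = pairCount R ω := by
    rw [Fintype.card_subtype, Finset.card_filter]
    push_cast
    rw [Fintype.sum_prod_type]
    refine Finset.sum_congr rfl fun i _ => ?_
    simp only [Fintype.sum_bool, hpt]
    simp [Set.indicator_apply, add_comm]
  have hn := (Set.ncard_le_ncard hsub (Set.toFinite _)).trans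
    ((Set.ncard_image_le (Set.toFinite _)).trans (hd.ncard_restrict_le fun p : P => (pt p.1).1))
  have hpos : 0 < (Set.range fun σ =>
      pairPattern {q : ℕ × (X × Bool) | q.2 ∈ R ∧ g q.1 q.2.1 ≠ q.2.2} ω (J σ)).ncard :=
    (Set.ncard_pos (Set.toFinite _)).2 (Set.range_nonempty _)
  have h1 := Real.log_le_log (by exact_mod_cast hpos) (by exact_mod_cast hn :
    ((Set.range fun σ => pairPattern {q : ℕ × (X × Bool) | q.2 ∈ R ∧ g q.1 q.2.1 ≠ q.2.2} ω
      (J σ)).ncard : ℝ) ≤ ((∑ i ∈ Finset.range (d + 1), (Fintype.card P).choose i : ℕ) : ℝ))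
  push_cast at h1
  refine h1.trans ((log_sum_range_choose_le _ d hx hx1).trans (le_of_eq ?_))
  rw [hcard]

variable [MeasurableSpace X]

theorem measurableSet_error {g : ℕ → X → Bool} (hg : ∀ j, Measurable (g j)) :
    MeasurableSet {q : ℕ × (X × Bool) | g q.1 q.2.1 ≠ q.2.2} := by
  have h1 : Measurable fun q : ℕ × (X × Bool) => g q.1 q.2.1 :=
    measurable_from_prod_countable_right fun j => (hg j).comp measurable_fst
  exact (measurableSet_eq_fun h1 (measurable_snd.comp measurable_snd)).compl

theorem integrable_pairCount (D : Measure (X × Bool)) [IsProbabilityMeasure D]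
    {R : Set (X × Bool)} (hR : MeasurableSet R) :
    Integrable (pairCount (ι := ι) R) (Measure.pi fun _ : ι => D.prod D) ∧
    ∫ ω, pairCount (ι := ι) R ω ∂(Measure.pi fun _ : ι => D.prod D) =
      2 * Fintype.card ι * D.real R := by
  set μ := Measure.pi fun _ : ι => D.prod D
  have hev : ∀ i : ι, MeasurePreserving (fun ω : ι → (X × Bool) × (X × Bool) => ω i) μ
      (D.prod D) := fun i => measurePreserving_eval (fun _ : ι => D.prod D) i
  have h1 : ∀ i : ι, MeasurePreserving (fun ω : ι → (X × Bool) × (X × Bool) => (ω i).1) μ D :=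
    fun i => measurePreserving_fst.comp (hev i)
  have h2 : ∀ i : ι, MeasurePreserving (fun ω : ι → (X × Bool) × (X × Bool) => (ω i).2) μ D :=
    fun i => measurePreserving_snd.comp (hev i)
  have hI : Integrable (R.indicator fun _ => (1 : ℝ)) D := (integrable_const 1).indicator hR
  have hi1 : ∀ i : ι, Integrable (fun ω => R.indicator (fun _ => (1 : ℝ)) (ω i).1) μ :=
    fun i => (h1 i).integrable_comp_of_integrable hI
  have hi2 : ∀ i : ι, Integrable (fun ω => R.indicator (fun _ => (1 : ℝ)) (ω i).2) μ :=
    fun i => (h2 i).integrable_comp_of_integrable hI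
  have hi : ∀ i : ι, Integrable (fun ω => R.indicator (fun _ => (1 : ℝ)) (ω i).1 +
      R.indicator (fun _ => (1 : ℝ)) (ω i).2) μ := fun i => (hi1 i).add (hi2 i)
  have key : ∀ f : (ι → (X × Bool) × (X × Bool)) → X × Bool, MeasurePreserving f μ D →
      ∫ ω, (R.indicator fun _ => (1 : ℝ)) (f ω) ∂μ = D.real R := by
    intro f hf
    have := integral_map (μ := μ) hf.measurable.aemeasurable
      (f := R.indicator fun _ => (1 : ℝ)) (by rw [hf.map_eq]; exact hI.aestronglyMeasurable)
    rw [← this, hf.map_eq, integral_indicator_const _ hR]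
    simp
  refine ⟨integrable_finsetSum _ fun i _ => hi i, ?_⟩
  unfold pairCount
  rw [integral_finsetSum _ fun i _ => hi i]
  have : ∀ i : ι, ∫ ω, (R.indicator (fun _ => (1 : ℝ)) (ω i).1 +
      R.indicator (fun _ => (1 : ℝ)) (ω i).2) ∂μ = 2 * D.real R := fun i => by
    rw [integral_add (hi1 i) (hi2 i), key _ (h1 i), key _ (h2 i)]; ring
  simp_rw [this]
  simp; ring

/-- The expected error of a consistent learner inside a region. -/
theorem error_in_region_le {H : Set (X → Bool)} {d : ℕ} (hd : HasVCDim H d)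
    {g : ℕ → X → Bool} (hg : ∀ j, g j ∈ H) (hgm : ∀ j, Measurable (g j))
    (D : Measure (X × Bool)) [IsProbabilityMeasure D] {a : (ι → X × Bool) → ℕ} (ha : Measurable a)
    (hcons : ∀ᵐ S ∂(Measure.pi fun _ : ι => D), ∀ i, g (a S) (S i).1 = (S i).2)
    {R : Set (X × Bool)} (hR : MeasurableSet R) {x : ℝ} (hx : 0 < x) (hx1 : x ≤ 1) :
    Real.log (3 / 2) * (Fintype.card ι * ((Measure.pi fun _ : ι => D).prod D).real
        {p | p.2 ∈ R ∧ g (a p.1) p.2.1 ≠ p.2.2}) ≤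
      d * Real.log (1 / x) + 2 * Fintype.card ι * D.real R * x := by
  have hQ : MeasurableSet {q : ℕ × (X × Bool) | q.2 ∈ R ∧ g q.1 q.2.1 ≠ q.2.2} :=
    (measurable_snd hR).inter (measurableSet_error hgm)
  obtain ⟨hci, hc⟩ := integrable_pairCount (ι := ι) D hR
  have h := symmetrization D ha hQ
    (b := fun ω => d * Real.log (1 / x) + pairCount R ω * x)
    ((integrable_const _).add (hci.mul_const _))
    (fun ω => log_ncard_pairPattern_le hd hg R ω _ hx hx1) true
  rw [integral_add (integrable_const _) (hci.mul_const _), integral_const, integral_mul_const,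
    hc] at h
  -- Consistency kills the training term, leaving only the held-out errors.
  have hzero : ∀ i, (Measure.pi fun _ : ι => D).real
      {S | (a S, S i) ∈ {q : ℕ × (X × Bool) | q.2 ∈ R ∧ g q.1 q.2.1 ≠ q.2.2}} = 0 := by
    intro i
    rw [measureReal_eq_zero_iff]
    refine measure_mono_null ?_ (ae_iff.1 hcons)
    intro S hS hall
    exact hS.2 (hall i)
  simp_rw [hzero] at h
  simpa using h

end Regions

/-! ### Level sets of the pointwise error probability and its second moment. -/

section SecondMoment

variable {X : Type u} [MeasurableSpace X] {ι : Type*} [Fintype ι]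

theorem measurableSet_pi_error {g : ℕ → X → Bool} (hgm : ∀ j, Measurable (g j))
    {Ω : Type*} [MeasurableSpace Ω] {a : Ω → ℕ} (ha : Measurable a) :
    MeasurableSet {p : Ω × (X × Bool) | g (a p.1) p.2.1 ≠ p.2.2} :=
  ((ha.comp measurable_fst).prodMk measurable_snd) (measurableSet_error hgm)

/-- The points that a consistent learner misclassifies with probability more than `s` have small
mass. -/
theorem measure_error_level_le {H : Set (X → Bool)} {d : ℕ} (hd : HasVCDim H d)
    {g : ℕ → X → Bool} (hg : ∀ j, g j ∈ H) (hgm : ∀ j, Measurable (g j))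
    (D : Measure (X × Bool)) [IsProbabilityMeasure D] {a : (ι → X × Bool) → ℕ} (ha : Measurable a)
    (hcons : ∀ᵐ S ∂(Measure.pi fun _ : ι => D), ∀ i, g (a S) (S i).1 = (S i).2)
    {s : ℝ} (hs : 0 < s) (hs1 : s ≤ 1) :
    Fintype.card ι * s * D.real {z | ENNReal.ofReal s <
        (Measure.pi fun _ : ι => D) {S | g (a S) z.1 ≠ z.2}} ≤ 6 * d * Real.log (12 / s) := by
  set μ := Measure.pi fun _ : ι => D with hμ
  have hE := measurableSet_pi_error hgm ha
  have hPm : Measurable fun z : X × Bool => μ {S | g (a S) z.1 ≠ z.2} :=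
    measurable_measure_prodMk_right hE
  set R := {z : X × Bool | ENNReal.ofReal s < μ {S | g (a S) z.1 ≠ z.2}} with hRdef
  have hR : MeasurableSet R := measurableSet_lt measurable_const hPm
  have hlow : s * D.real R ≤ (μ.prod D).real {p | p.2 ∈ R ∧ g (a p.1) p.2.1 ≠ p.2.2} := by
    have h1 : ENNReal.ofReal s * D R ≤ (μ.prod D) {p | p.2 ∈ R ∧ g (a p.1) p.2.1 ≠ p.2.2} := by
      have hM : MeasurableSet
          {p : (ι → X × Bool) × (X × Bool) | p.2 ∈ R ∧ g (a p.1) p.2.1 ≠ p.2.2} :=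
        (measurable_snd hR).inter hE
      rw [Measure.prod_apply_symm hM, ← setLIntegral_const]
      rw [← lintegral_indicator hR]
      refine lintegral_mono fun z => ?_
      by_cases hz : z ∈ R
      · rw [Set.indicator_of_mem hz]
        refine (le_of_lt hz).trans (measure_mono fun S hS => ?_)
        exact ⟨hz, hS⟩
      · rw [Set.indicator_of_notMem hz]; exact zero_le
    have h2 := ENNReal.toReal_mono (measure_ne_top _ _) h1
    rwa [ENNReal.toReal_mul, ENNReal.toReal_ofReal hs.le] at h2
  -- With `x = s / 12` the region term is `k s D(R) / 6`, half of the lower bound `k s D(R) / 3`,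
  -- and can be absorbed.
  have h := error_in_region_le hd hg hgm D ha hcons hR (x := s / 12) (by positivity)
    (by linarith)
  have hl3 : 1 / 3 ≤ Real.log (3 / 2) := by
    have := Real.one_sub_inv_le_log_of_pos (show (0 : ℝ) < 3 / 2 by norm_num)
    norm_num at this ⊢; exact this
  have hk : (0 : ℝ) ≤ Fintype.card ι := by positivity
  have h3 : 1 / 3 * (Fintype.card ι * (s * D.real R)) ≤ Real.log (3 / 2) *
      (Fintype.card ι * (μ.prod D).real {p | p.2 ∈ R ∧ g (a p.1) p.2.1 ≠ p.2.2}) := by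
    gcongr
  have h4 : (1 : ℝ) / (s / 12) = 12 / s := by field_simp
  rw [h4] at h
  have h5 := h3.trans h
  linarith

/-- A crude growth of `2^i` suffices: level `i` of the second moment then contributes `16^(-i) * 4^i
* 2^i = 2^(-i)` up to constants. -/
theorem log_twelve_mul_four_pow_le (i : ℕ) :
    Real.log (12 / (1 / 4) ^ (i + 1)) ≤ 16 * 2 ^ i := by
  have h1 : (12 : ℝ) / (1 / 4) ^ (i + 1) ≤ 2 ^ (6 + 2 * i) := by
    have e1 : (2 : ℝ) ^ (6 + 2 * i) = 64 * 4 ^ i := by rw [pow_add, pow_mul]; norm_num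
    have e2 : (12 : ℝ) / (1 / 4) ^ (i + 1) = 48 * 4 ^ i := by
      rw [one_div, inv_pow, div_inv_eq_mul, pow_succ]; ring
    have : (0 : ℝ) < 4 ^ i := by positivity
    rw [e1, e2]
    linarith
  have h2 := Real.log_le_log (by positivity) h1
  rw [Real.log_pow] at h2
  have h3 : Real.log 2 ≤ 1 := by linarith [Real.log_two_lt_d9]
  have h4 : (i : ℝ) ≤ 2 ^ i := by exact_mod_cast (Nat.lt_two_pow_self (n := i)).le
  have h5 : (1 : ℝ) ≤ 2 ^ i := one_le_pow₀ (by norm_num)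
  have h6 : ((6 + 2 * i : ℕ) : ℝ) * Real.log 2 ≤ ((6 + 2 * i : ℕ) : ℝ) * 1 := by gcongr
  push_cast at h6 h2
  linarith

theorem sq_le_tsum_levels {p : ℝ≥0∞} (hp : p ≤ 1) :
    p ^ 2 ≤ ∑' i : ℕ, if ENNReal.ofReal ((1 / 4) ^ (i + 1)) < p then
      ENNReal.ofReal ((1 / 16) ^ i) else 0 := by
  rcases eq_or_ne p 0 with rfl | h0
  · simp
  have hpt : p ≠ ⊤ := ne_top_of_le_ne_top ENNReal.one_ne_top hp
  have hpos : 0 < p.toReal := ENNReal.toReal_pos h0 hpt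
  have hle : p.toReal ≤ 1 := by simpa using ENNReal.toReal_mono ENNReal.one_ne_top hp
  -- The level with `(1/4)^(i+1) < p ≤ (1/4)^i`; its single term already dominates `p ^ 2`.
  obtain ⟨i, hi1, hi2⟩ := exists_nat_pow_near_of_lt_one hpos hle
    (show (0 : ℝ) < 1 / 4 by norm_num) (by norm_num)
  refine le_trans ?_ (ENNReal.le_tsum i)
  have h1 : ENNReal.ofReal ((1 / 4) ^ (i + 1)) < p := by
    rwa [← ENNReal.ofReal_toReal hpt, ENNReal.ofReal_lt_ofReal_iff hpos]
  rw [if_pos h1]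
  nth_rewrite 1 [← ENNReal.ofReal_toReal hpt]
  rw [← ENNReal.ofReal_pow hpos.le]
  refine ENNReal.ofReal_le_ofReal ?_
  calc p.toReal ^ 2 ≤ ((1 / 4) ^ i) ^ 2 := by gcongr
    _ = (1 / 16) ^ i := by rw [← pow_mul, mul_comm, pow_mul]; norm_num

/-- The probability that two independent runs of a consistent learner both err at a random point
is of the optimal order `d / k`. -/
theorem lintegral_error_sq_le {H : Set (X → Bool)} {d : ℕ} (hd : HasVCDim H d)
    {g : ℕ → X → Bool} (hg : ∀ j, g j ∈ H) (hgm : ∀ j, Measurable (g j))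
    (D : Measure (X × Bool)) [IsProbabilityMeasure D] {a : (ι → X × Bool) → ℕ} (ha : Measurable a)
    (hcons : ∀ᵐ S ∂(Measure.pi fun _ : ι => D), ∀ i, g (a S) (S i).1 = (S i).2)
    (hk : 0 < Fintype.card ι) :
    ∫⁻ z, ((Measure.pi fun _ : ι => D) {S | g (a S) z.1 ≠ z.2}) ^ 2 ∂D ≤
      ENNReal.ofReal (768 * d / Fintype.card ι) := by
  set μ := Measure.pi fun _ : ι => D with hμ
  have hPm : Measurable fun z : X × Bool => μ {S | g (a S) z.1 ≠ z.2} :=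
    measurable_measure_prodMk_right (measurableSet_pi_error hgm ha)
  have hk' : (0 : ℝ) < Fintype.card ι := by exact_mod_cast hk
  have hRm : ∀ i : ℕ, MeasurableSet
      {z : X × Bool | ENNReal.ofReal ((1 / 4) ^ (i + 1)) < μ {S | g (a S) z.1 ≠ z.2}} := fun i =>
    measurableSet_lt measurable_const hPm
  have hR : ∀ i : ℕ,
      D {z | ENNReal.ofReal ((1 / 4) ^ (i + 1)) < μ {S | g (a S) z.1 ≠ z.2}} ≤
        ENNReal.ofReal (384 * d / Fintype.card ι * 8 ^ i) := by
    intro i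
    have h1 := measure_error_level_le hd hg hgm D ha hcons (s := (1 / 4) ^ (i + 1))
      (by positivity) (pow_le_one₀ (by norm_num) (by norm_num))
    rw [← ENNReal.ofReal_toReal (measure_ne_top D _)]
    refine ENNReal.ofReal_le_ofReal ?_
    have h2 : 6 * d * Real.log (12 / (1 / 4) ^ (i + 1)) ≤ 6 * d * (16 * 2 ^ i) :=
      mul_le_mul_of_nonneg_left (log_twelve_mul_four_pow_le i) (by positivity)
    have h3 := h1.trans h2
    rw [div_mul_eq_mul_div, le_div_iff₀ hk']
    have h4 : (0 : ℝ) < 4 ^ (i + 1) := by positivity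
    have h5 : ((1 : ℝ) / 4) ^ (i + 1) * 4 ^ (i + 1) = 1 := by
      rw [← mul_pow]; norm_num
    have h6 : (8 : ℝ) ^ i = 2 ^ i * 4 ^ i := by rw [← mul_pow]; norm_num
    have h7 := mul_le_mul_of_nonneg_right h3 h4.le
    set r := D.real {z | ENNReal.ofReal ((1 / 4) ^ (i + 1)) < μ {S | g (a S) z.1 ≠ z.2}} with hr
    have h8 : r * Fintype.card ι ≤ 6 * d * (16 * 2 ^ i) * 4 ^ (i + 1) := by
      linear_combination h7 - r * Fintype.card ι * h5
    refine h8.trans (le_of_eq ?_)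
    rw [h6, pow_succ]; ring
  calc ∫⁻ z, (μ {S | g (a S) z.1 ≠ z.2}) ^ 2 ∂D
      ≤ ∫⁻ z, ∑' i : ℕ, {z : X × Bool | ENNReal.ofReal ((1 / 4) ^ (i + 1)) <
          μ {S | g (a S) z.1 ≠ z.2}}.indicator (fun _ => ENNReal.ofReal ((1 / 16) ^ i)) z ∂D := by
        refine lintegral_mono fun z => (sq_le_tsum_levels prob_le_one).trans (le_of_eq ?_)
        refine tsum_congr fun i => ?_
        simp [Set.indicator_apply]
    _ = ∑' i : ℕ, ENNReal.ofReal ((1 / 16) ^ i) *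
          D {z | ENNReal.ofReal ((1 / 4) ^ (i + 1)) < μ {S | g (a S) z.1 ≠ z.2}} := by
        rw [lintegral_tsum fun i => (measurable_const.indicator (hRm i)).aemeasurable]
        refine tsum_congr fun i => ?_
        rw [lintegral_indicator (hRm i), setLIntegral_const]
    _ ≤ ∑' i : ℕ, ENNReal.ofReal (384 * d / Fintype.card ι * (1 / 2) ^ i) := by
        refine ENNReal.tsum_le_tsum fun i => ?_
        refine (mul_le_mul_right (hR i) _).trans (le_of_eq ?_)
        rw [← ENNReal.ofReal_mul (by positivity)]
        congr 1
        have : ((1 : ℝ) / 16) ^ i * 8 ^ i = (1 / 2) ^ i := by rw [← mul_pow]; norm_num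
        rw [← this]; ring
    _ = ENNReal.ofReal (768 * d / Fintype.card ι) := by
        rw [← ENNReal.ofReal_tsum_of_nonneg (fun i => by positivity)
          (summable_geometric_two.mul_left _), tsum_mul_left, tsum_geometric_two]
        congr 1; ring

end SecondMoment

/-! ### The first consistent concept of an enumeration. -/

section FirstConsistent

variable {X : Type u} {ι : Type*}

/-- The index of the first concept that is consistent with the sample, or `0` if there is none. -/
noncomputable def firstConsistent (g : ℕ → X → Bool) (S : ι → X × Bool) : ℕ :=
  sInf {j | ∀ i, g j (S i).1 = (S i).2}

theorem firstConsistent_spec {g : ℕ → X → Bool} {S : ι → X × Bool}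
    (h : ∃ j, ∀ i, g j (S i).1 = (S i).2) (i : ι) :
    g (firstConsistent g S) (S i).1 = (S i).2 :=
  Nat.sInf_mem (s := {j | ∀ i, g j (S i).1 = (S i).2}) h i

theorem firstConsistent_eq_zero {g : ℕ → X → Bool} {S : ι → X × Bool}
    (h : ¬ ∃ j, ∀ i, g j (S i).1 = (S i).2) : firstConsistent g S = 0 :=
  Nat.sInf_eq_zero.2 (Or.inr (Set.eq_empty_of_forall_notMem fun j hj => h ⟨j, hj⟩))

/-- If the output is consistent, so is `g j`, and minimality applies. If nothing is consistent, the
default `0` is least anyway; this covers the non-realizable samples that a tracer may use. -/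
theorem firstConsistent_le_of_agree {g : ℕ → X → Bool} {S : ι → X × Bool} {j : ℕ}
    (h : ∀ i, g (firstConsistent g S) (S i).1 = g j (S i).1) : firstConsistent g S ≤ j := by
  by_cases hex : ∃ j, ∀ i, g j (S i).1 = (S i).2
  · exact Nat.sInf_le fun i => (h i).symm.trans (firstConsistent_spec hex i)
  · rw [firstConsistent_eq_zero hex]
    exact Nat.zero_le j

/-- The first consistent concept is determined by its labels on any finite set that contains the
sample. -/
theorem HasVCDim.ncard_firstConsistent_le [Fintype ι] {κ : Type*} [Fintype κ] {H : Set (X → Bool)}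
    {d : ℕ} (hd : HasVCDim H d) {g : ℕ → X → Bool} (hg : ∀ j, g j ∈ H) (pt : κ → X × Bool) :
    (Set.range fun f : ι → κ => firstConsistent g (pt ∘ f)).ncard ≤
      (Fintype.card κ + 1) ^ d := by
  classical
  refine le_trans ?_ ((hd.ncard_restrict_le fun k => (pt k).1).trans
    (sum_range_choose_le_add_one_pow _ _))
  refine Set.ncard_le_ncard_of_injOn (fun j k => g j (pt k).1) ?_ ?_ (Set.toFinite _)
  · rintro _ ⟨f, rfl⟩
    exact ⟨_, hg _, rfl⟩
  · rintro _ ⟨f, rfl⟩ _ ⟨f', rfl⟩ h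
    exact le_antisymm (firstConsistent_le_of_agree fun i => congrFun h (f i))
      (firstConsistent_le_of_agree fun i => (congrFun h (f' i)).symm)

theorem measurable_firstConsistent [MeasurableSpace X] [Finite ι] {g : ℕ → X → Bool}
    (hg : ∀ j, Measurable (g j)) :
    Measurable (firstConsistent g : (ι → X × Bool) → ℕ) := by
  have hC : ∀ j, MeasurableSet {S : ι → X × Bool | ∀ i, g j (S i).1 = (S i).2} := fun j => by
    rw [Set.ofPred_forall]
    refine MeasurableSet.iInter fun i => measurableSet_eq_fun ?_ ?_
    · exact (hg j).comp (measurable_fst.comp (measurable_pi_apply i))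
    · exact measurable_snd.comp (measurable_pi_apply i)
  refine measurable_to_nat fun S₀ => ?_
  set m := firstConsistent g S₀
  have : firstConsistent g ⁻¹' {m} =
      {S : ι → X × Bool | (∀ i, g m (S i).1 = (S i).2) ∧
        ∀ j < m, ¬ ∀ i, g j (S i).1 = (S i).2} ∪
      {S : ι → X × Bool | m = 0 ∧ ∀ j, ¬ ∀ i, g j (S i).1 = (S i).2} := by
    ext S
    simp only [Set.mem_preimage, Set.mem_singleton_iff, Set.mem_union, Set.mem_ofPred_eq]
    constructor
    · intro h
      by_cases hex : ∃ j, ∀ i, g j (S i).1 = (S i).2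
      · refine Or.inl ⟨fun i => h ▸ firstConsistent_spec hex i, fun j hj hc => ?_⟩
        have : firstConsistent g S ≤ j := Nat.sInf_le hc
        omega
      · exact Or.inr ⟨h.symm.trans (firstConsistent_eq_zero hex), not_exists.1 hex⟩
    · rintro (⟨h1, h2⟩ | ⟨h1, h2⟩)
      · refine le_antisymm (Nat.sInf_le h1) ?_
        by_contra hlt
        exact h2 _ (not_le.1 hlt) (firstConsistent_spec ⟨m, h1⟩)
      · rw [h1, firstConsistent_eq_zero (not_exists.2 h2)]
  have h1 : MeasurableSet {S : ι → X × Bool | ∀ j < m, ¬ ∀ i, g j (S i).1 = (S i).2} := by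
    simp_rw [Set.ofPred_forall]
    exact MeasurableSet.iInter fun j => MeasurableSet.iInter fun _ => (hC j).compl
  have h2 : MeasurableSet {S : ι → X × Bool | ∀ j, ¬ ∀ i, g j (S i).1 = (S i).2} := by
    rw [Set.ofPred_forall]
    exact MeasurableSet.iInter fun j => (hC j).compl
  rw [this]
  exact ((hC m).inter h1).union ((MeasurableSet.const _).inter h2)

end FirstConsistent

/-! ### Splitting the sample into three blocks and voting. -/

section Majority

variable {X : Type u} {n : ℕ}

/-- The indices of the sample points in the `r`-th of three interleaved blocks. -/
def block (n : ℕ) (r : Fin 3) : Finset (Fin n) := Finset.univ.filter fun i => i.1 % 3 = r.1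

theorem disjoint_block {r s : Fin 3} (h : r ≠ s) : Disjoint (block n r) (block n s) := by
  rw [Finset.disjoint_left]
  intro i hi hj
  simp only [block, Finset.mem_filter, Finset.mem_univ, true_and] at hi hj
  exact h (Fin.ext (hi.symm.trans hj))

theorem div_three_le_card_block (n : ℕ) (r : Fin 3) : n / 3 ≤ (block n r).card := by
  have := Finset.card_le_card_of_injOn (s := Finset.univ (α := Fin (n / 3))) (t := block n r)
    (fun j => ⟨3 * j.1 + r.1, by omega⟩) (fun j _ => by simp [block])
    (fun j _ k _ h => by simp at h; omega)
  simpa using this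

/-- The first concepts that are consistent with the three blocks of the sample. -/
noncomputable def blockOutput (g : ℕ → X → Bool) (S : Fin n → X × Bool) (r : Fin 3) : ℕ :=
  firstConsistent g fun i : block n r => S i

/-- The majority vote of three concepts. -/
def majority (g : ℕ → X → Bool) (θ : Fin 3 → ℕ) (x : X) : Bool :=
  (g (θ 0) x && g (θ 1) x) || (g (θ 0) x && g (θ 2) x) || (g (θ 1) x && g (θ 2) x)

theorem majority_error {g : ℕ → X → Bool} {θ : Fin 3 → ℕ} {x : X} {y : Bool}
    (h : majority g θ x ≠ y) :
    (g (θ 0) x ≠ y ∧ g (θ 1) x ≠ y) ∨ (g (θ 0) x ≠ y ∧ g (θ 2) x ≠ y) ∨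
      (g (θ 1) x ≠ y ∧ g (θ 2) x ≠ y) := by
  revert h
  unfold majority
  cases g (θ 0) x <;> cases g (θ 1) x <;> cases g (θ 2) x <;> cases y <;> simp

variable [MeasurableSpace X]

theorem measurable_blockOutput {g : ℕ → X → Bool} (hg : ∀ j, Measurable (g j)) :
    Measurable (blockOutput g : (Fin n → X × Bool) → Fin 3 → ℕ) :=
  measurable_pi_lambda _ fun _ => (measurable_firstConsistent hg).comp
    (measurable_pi_lambda _ fun i => measurable_pi_apply i.1)

theorem measurable_majority {g : ℕ → X → Bool} (hg : ∀ j, Measurable (g j)) :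
    Measurable fun p : (Fin 3 → ℕ) × X => majority g p.1 p.2 :=
  measurable_from_prod_countable_right fun θ => by
    exact (measurable_of_countable fun b : Bool × Bool × Bool =>
      (b.1 && b.2.1) || (b.1 && b.2.2) || (b.2.1 && b.2.2)).comp
      ((hg (θ 0)).prodMk ((hg (θ 1)).prodMk (hg (θ 2))))

end Majority

/-! ### Risk and traceability of deterministic learners. -/

section Deterministic

variable {X : Type u} [MeasurableSpace X] {n : ℕ}

/-- The learner that outputs the parameter `f S` on the sample `S`. -/
noncomputable def Learner.ofFun {Θ : Type u} [MeasurableSpace Θ] (predict : Θ → X → Bool)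
    (hp : Measurable (Function.uncurry predict)) (f : (Fin n → X × Bool) → Θ)
    (hf : Measurable f) : Learner X n where
  Θ := Θ
  predict := predict
  measurable_predict := hp
  kernel := Kernel.deterministic f hf

theorem measurePreserving_tail_head {Z : Type*} [MeasurableSpace Z] (D : Measure Z)
    [IsProbabilityMeasure D] :
    MeasurePreserving (fun z : Fin (n + 1) → Z => ((fun i : Fin n => z i.succ), z 0))
      (Measure.pi fun _ : Fin (n + 1) => D) ((Measure.pi fun _ : Fin n => D).prod D) :=
  Measure.measurePreserving_swap.comp
    (measurePreserving_piFinSuccAbove (fun _ : Fin (n + 1) => D) 0)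

variable {Θ : Type u} [MeasurableSpace Θ] {predict : Θ → X → Bool}
  {hp : Measurable (Function.uncurry predict)} {f : (Fin n → X × Bool) → Θ} {hf : Measurable f}

theorem Learner.expectedRisk_ofFun (D : Measure (X × Bool)) [IsProbabilityMeasure D] :
    (Learner.ofFun predict hp f hf).expectedRisk D =
      ((Measure.pi fun _ : Fin n => D).prod D) {p | predict (f p.1) p.2.1 ≠ p.2.2} := by
  have hE : MeasurableSet {q : Θ × (X × Bool) | predict q.1 q.2.1 ≠ q.2.2} := by
    refine (measurableSet_eq_fun ?_ (measurable_snd.comp measurable_snd)).compl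
    exact hp.comp (measurable_fst.prodMk (measurable_fst.comp measurable_snd))
  have hE' : MeasurableSet {p : (Fin n → X × Bool) × (X × Bool) |
      predict (f p.1) p.2.1 ≠ p.2.2} := ((hf.comp measurable_fst).prodMk measurable_snd) hE
  rw [Measure.prod_apply hE']
  refine lintegral_congr fun S => ?_
  exact Kernel.lintegral_deterministic' hf (measurable_measure_prodMk_left hE)

/-- Only the event that the score passes the threshold matters, so the tracer becomes a measurable
set `Q`; a deterministic kernel lets the parameter be replaced by `f` of the sample. -/
theorem Learner.IsTraceable.exists_of_ofFun {ξ : ℝ} {m : ℕ}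
    (h : (Learner.ofFun predict hp f hf).IsTraceable ξ m) :
    ∃ (Q : Set (Θ × (X × Bool))) (D : Measure (X × Bool)), MeasurableSet Q ∧
      IsProbabilityMeasure D ∧
      (Measure.pi fun _ : Fin (n + 1) => D) {z | (f fun i => z i.succ, z 0) ∈ Q} ≤
        ENNReal.ofReal ξ ∧
      (m : ℝ≥0∞) ≤ ∑ i : Fin n,
        (Measure.pi fun _ : Fin (n + 1) => D) {z | (f fun i => z i.succ, z i.succ) ∈ Q} := by
  obtain ⟨φ, D, t, hφ, hD, h1, h2⟩ := h
  change Θ → X × Bool → ℝ at φ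
  have hQ : MeasurableSet {q : Θ × (X × Bool) | t ≤ φ q.1 q.2} :=
    measurableSet_le measurable_const hφ
  have htail : Measurable fun (z : Fin (n + 1) → X × Bool) (i : Fin n) => z i.succ :=
    measurable_pi_lambda _ fun i => measurable_pi_apply i.succ
  obtain ⟨ν, hν⟩ : ∃ ν : Measure ((Fin (n + 1) → X × Bool) × Θ),
      ν = (Measure.pi fun _ : Fin (n + 1) => D) ⊗ₘ
        ((Kernel.deterministic f hf).comap (fun z (i : Fin n) => z i.succ) htail) := ⟨_, rfl⟩
  replace h1 : ν {ω | t ≤ φ ω.2 (ω.1 0)} ≤ ENNReal.ofReal ξ := hν ▸ h1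
  replace h2 : (m : ℝ≥0∞) ≤ ∫⁻ ω, (((Finset.univ.filter fun i : Fin n =>
      t ≤ φ ω.2 (ω.1 i.succ)).card : ℕ) : ℝ≥0∞) ∂ν := hν ▸ h2
  have hm : ∀ i : Fin (n + 1), MeasurableSet
      {ω : (Fin (n + 1) → X × Bool) × Θ | t ≤ φ ω.2 (ω.1 i)} := fun i =>
    measurableSet_le measurable_const
      (hφ.comp (measurable_snd.prodMk ((measurable_pi_apply i).comp measurable_fst)))
  have key : ∀ i : Fin (n + 1), ν {ω | t ≤ φ ω.2 (ω.1 i)} =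
      (Measure.pi fun _ : Fin (n + 1) => D) {z : Fin (n + 1) → X × Bool |
        (f fun i => z i.succ, z i) ∈ {q : Θ × (X × Bool) | t ≤ φ q.1 q.2}} := by
    intro i
    have hm' : MeasurableSet {z : Fin (n + 1) → X × Bool |
        (f fun i => z i.succ, z i) ∈ {q : Θ × (X × Bool) | t ≤ φ q.1 q.2}} :=
      ((hf.comp htail).prodMk (measurable_pi_apply i)) hQ
    rw [hν, Measure.compProd_apply (hm i), ← lintegral_indicator_one hm']
    refine lintegral_congr fun z => ?_
    rw [Kernel.comap_apply, Kernel.deterministic_apply' hf _ (measurable_prodMk_left (hm i))]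
    rfl
  refine ⟨_, D, hQ, hD, (key 0) ▸ h1, h2.trans (le_of_eq ?_)⟩
  rw [← Finset.sum_congr rfl fun (i : Fin n) _ =>
    (lintegral_indicator_one (hm i.succ)).trans (key i.succ)]
  rw [← lintegral_finsetSum _ fun i _ => measurable_one.indicator (hm i.succ)]
  refine lintegral_congr fun ω => ?_
  rw [Finset.card_filter]
  push_cast
  refine Finset.sum_congr rfl fun i _ => ?_
  simp [Set.indicator_apply]

end Deterministic

/-! ### Recall bound for the majority learner. -/

section MajorityLearner

variable {X : Type u} {n : ℕ}

/-- All outputs on subsamples of a paired sample take few values. -/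
theorem log_ncard_pairPattern_blockOutput_le {H : Set (X → Bool)} {d : ℕ} (hd : HasVCDim H d)
    {g : ℕ → X → Bool} (hg : ∀ j, g j ∈ H) (Q : Set ((Fin 3 → ℕ) × (X × Bool)))
    (ω : Fin n → (X × Bool) × (X × Bool)) :
    Real.log (Set.range fun σ : Fin n → Bool =>
        pairPattern Q ω (blockOutput g fun i => (swapBy σ ω i).1)).ncard ≤
      3 * d * Real.log (2 * n + 1) := by
  classical
  set pt : Fin n × Bool → X × Bool := fun p => if p.2 then (ω p.1).2 else (ω p.1).1 with hpt
  set J : Fin 3 → Set ℕ := fun r =>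
    Set.range fun f : block n r → Fin n × Bool => firstConsistent g (pt ∘ f)
  have hJ : ∀ r, (J r).ncard ≤ (2 * n + 1) ^ d := fun r => by
    have := hd.ncard_firstConsistent_le (ι := block n r) hg pt
    simpa [mul_comm] using this
  have hJf : ∀ r, (J r).Finite := fun r => Set.finite_range _
  set T : Finset (Fin 3 → ℕ) := Fintype.piFinset fun r => (hJf r).toFinset
  have hT : T.card ≤ ((2 * n + 1) ^ d) ^ 3 := by
    rw [Fintype.card_piFinset]
    have : ∀ r, (hJf r).toFinset.card ≤ (2 * n + 1) ^ d := fun r => by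
      rw [← Set.ncard_eq_toFinset_card _ (hJf r)]
      exact hJ r
    simpa using Finset.prod_le_prod' (s := Finset.univ) fun r _ => this r
  have hsub : (Set.range fun σ : Fin n → Bool =>
      pairPattern Q ω (blockOutput g fun i => (swapBy σ ω i).1)) ⊆
      ((T.image (pairPattern Q ω) : Finset _) : Set (Fin n → Bool × Bool)) := by
    rintro _ ⟨σ, rfl⟩
    rw [Finset.coe_image]
    refine ⟨_, ?_, rfl⟩
    rw [Finset.mem_coe, Fintype.mem_piFinset]
    intro r
    rw [Set.Finite.mem_toFinset]
    refine ⟨fun i => (i.1, σ i.1), ?_⟩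
    refine congrArg (firstConsistent g) (funext fun i => ?_)
    by_cases h : σ i.1 = true <;> simp [hpt, swapBy, h]
  have hn : (Set.range fun σ : Fin n → Bool =>
      pairPattern Q ω (blockOutput g fun i => (swapBy σ ω i).1)).ncard ≤ ((2 * n + 1) ^ d) ^ 3 := by
    refine (Set.ncard_le_ncard hsub (Finset.finite_toSet _)).trans ?_
    rw [Set.ncard_coe_finset]
    exact Finset.card_image_le.trans hT
  have hpos : 0 < (Set.range fun σ : Fin n → Bool =>
      pairPattern Q ω (blockOutput g fun i => (swapBy σ ω i).1)).ncard :=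
    (Set.ncard_pos (Set.toFinite _)).2 (Set.range_nonempty _)
  have h1 := Real.log_le_log (by exact_mod_cast hpos) (by exact_mod_cast hn :
    ((Set.range fun σ : Fin n → Bool =>
      pairPattern Q ω (blockOutput g fun i => (swapBy σ ω i).1)).ncard : ℝ) ≤
        (((2 * (n : ℝ) + 1) ^ d) ^ 3))
  refine h1.trans (le_of_eq ?_)
  rw [Real.log_pow, Real.log_pow]
  push_cast
  ring

variable [MeasurableSpace X]

/-- The majority vote of the first consistent concepts of three disjoint blocks of the sample. -/
noncomputable def majorityLearner (n : ℕ) {g : ℕ → X → Bool} (hg : ∀ j, Measurable (g j)) :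
    Learner X n :=
  Learner.ofFun (Θ := ULift.{u} (Fin 3 → ℕ)) (fun θ => majority g θ.down)
    ((measurable_majority hg).comp ((measurable_down.comp measurable_fst).prodMk measurable_snd))
    (fun S => ULift.up (blockOutput g S)) (measurable_up.comp (measurable_blockOutput hg))

theorem majorityLearner_recall_le {H : Set (X → Bool)} {d : ℕ} (hd : HasVCDim H d)
    {g : ℕ → X → Bool} (hg : ∀ j, g j ∈ H) (hgm : ∀ j, Measurable (g j)) {ξ : ℝ} (hξ : 0 ≤ ξ)
    {m : ℕ} (h : (majorityLearner n hgm).IsTraceable ξ m) :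
    (m : ℝ) ≤ 2 * (n * ξ) + 9 * d * Real.log (2 * n + 1) := by
  obtain ⟨Q, D, hQ, hD, h1, h2⟩ := h.exists_of_ofFun
  set Q' : Set ((Fin 3 → ℕ) × (X × Bool)) := {q | (ULift.up q.1, q.2) ∈ Q} with hQ'
  have hQm : MeasurableSet Q' := ((measurable_up.comp measurable_fst).prodMk measurable_snd) hQ
  have ha := measurable_blockOutput (n := n) hgm
  have hs := symmetrization D ha hQm
    (b := fun _ => 3 * d * Real.log (2 * n + 1)) (integrable_const _)
    (fun ω => log_ncard_pairPattern_blockOutput_le hd hg Q' ω) false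
  have hmp := measurePreserving_tail_head (n := n) D
  have e1 : (Measure.pi fun _ : Fin (n + 1) => D)
      {z | (ULift.up (blockOutput g fun i => z i.succ), z 0) ∈ Q} =
      ((Measure.pi fun _ : Fin n => D).prod D) {p | (blockOutput g p.1, p.2) ∈ Q'} := by
    have hm : MeasurableSet {p : (Fin n → X × Bool) × (X × Bool) |
      (blockOutput g p.1, p.2) ∈ Q'} := ((ha.comp measurable_fst).prodMk measurable_snd) hQm
    exact hmp.measure_preimage hm.nullMeasurableSet
  have e2 : ∀ i : Fin n, (Measure.pi fun _ : Fin (n + 1) => D)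
      {z | (ULift.up (blockOutput g fun i => z i.succ), z i.succ) ∈ Q} =
      (Measure.pi fun _ : Fin n => D) {S | (blockOutput g S, S i) ∈ Q'} := fun i => by
    have hm : MeasurableSet {S : Fin n → X × Bool | (blockOutput g S, S i) ∈ Q'} :=
      (ha.prodMk (measurable_pi_apply i)) hQm
    exact (measurePreserving_fst.comp hmp).measure_preimage hm.nullMeasurableSet
  rw [e1] at h1
  simp_rw [e2] at h2
  have h1' := ENNReal.toReal_mono ENNReal.ofReal_ne_top h1
  rw [ENNReal.toReal_ofReal hξ] at h1'
  have h2' := ENNReal.toReal_mono (ENNReal.sum_ne_top.2 fun i _ => measure_ne_top _ _) h2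
  rw [ENNReal.toReal_natCast, ENNReal.toReal_sum fun i _ => measure_ne_top _ _] at h2'
  change _ ≤ ∑ i, (Measure.pi fun _ : Fin n => D).real {S | (blockOutput g S, S i) ∈ Q'} at h2'
  change ((Measure.pi fun _ : Fin n => D).prod D).real _ ≤ ξ at h1'
  simp only [Bool.false_eq_true, if_false, one_mul, Fintype.card_fin, integral_const,
    probReal_univ, smul_eq_mul] at hs
  have hl3 : 1 / 3 ≤ Real.log (3 / 2) := by
    have := Real.one_sub_inv_le_log_of_pos (show (0 : ℝ) < 3 / 2 by norm_num)
    norm_num at this ⊢; exact this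
  have hn : (n : ℝ) * ((Measure.pi fun _ : Fin n => D).prod D).real
      {p | (blockOutput g p.1, p.2) ∈ Q'} ≤ n * ξ := by gcongr
  have hlog : 0 ≤ 3 * d * Real.log (2 * n + 1) := by
    have : 0 ≤ Real.log (2 * (n : ℝ) + 1) := Real.log_nonneg (by
      have : (0 : ℝ) ≤ n := by positivity
      linarith)
    positivity
  -- The negated goal makes `m - 2 * (n * ξ)` nonnegative, so `log (3 / 2)` may be replaced by its
  -- lower bound `1 / 3`.
  by_contra hcon
  rw [not_le] at hcon
  have h5 : Real.log (3 / 2) * (m - 2 * (n * ξ)) ≤ 3 * d * Real.log (2 * n + 1) := by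
    refine le_trans ?_ hs
    gcongr
    linarith
  have h6 : 1 / 3 * (m - 2 * (n * ξ)) ≤ Real.log (3 / 2) * (m - 2 * (n * ξ)) := by
    gcongr
    linarith
  linarith

end MajorityLearner

/-! ### Risk bound of order `d / n` for the majority learner. -/

section MajorityRisk

variable {X : Type u} [MeasurableSpace X] {n : ℕ}

theorem measurePreserving_restrict_finset {ι Z : Type*} [Fintype ι] [MeasurableSpace Z]
    (D : Measure Z) [IsProbabilityMeasure D] (I : Finset ι) :
    MeasurePreserving (fun (S : ι → Z) (i : I) => S i) (Measure.pi fun _ : ι => D)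
      (Measure.pi fun _ : I => D) := by
  classical
  convert! measurePreserving_fst.comp
    (measurePreserving_piEquivPiSubtypeProd (fun _ : ι => D) fun i => i ∈ I)

theorem ae_firstConsistent {ι : Type*} [Fintype ι] {H : Set (X → Bool)} {g : ℕ → X → Bool}
    (hdense : ∀ h ∈ H, ∀ s : Finset X, ∃ j, ∀ x ∈ s, g j x = h x) {D : Measure (X × Bool)}
    [IsProbabilityMeasure D] (hD : Realizable H D) :
    ∀ᵐ S ∂(Measure.pi fun _ : ι => D), ∀ i, g (firstConsistent g S) (S i).1 = (S i).2 := by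
  classical
  obtain ⟨h, hh, hae⟩ := hD
  have h1 : ∀ᵐ S ∂(Measure.pi fun _ : ι => D), ∀ i, h (S i).1 = (S i).2 :=
    ae_all_iff.2 fun i =>
      (measurePreserving_eval (fun _ : ι => D) i).quasiMeasurePreserving.ae hae
  filter_upwards [h1] with S hS
  obtain ⟨j, hj⟩ := hdense h hh (Finset.univ.image fun i => (S i).1)
  exact firstConsistent_spec ⟨j, fun i =>
    (hj _ (Finset.mem_image_of_mem _ (Finset.mem_univ i))).trans (hS i)⟩

/-- The two outputs read disjoint sets of independent coordinates. -/
theorem blockOutput_error_inter {g : ℕ → X → Bool} (hgm : ∀ j, Measurable (g j))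
    (D : Measure (X × Bool)) [IsProbabilityMeasure D] (z : X × Bool) {r s : Fin 3} (hrs : r ≠ s) :
    (Measure.pi fun _ : Fin n => D)
        {S | g (blockOutput g S r) z.1 ≠ z.2 ∧ g (blockOutput g S s) z.1 ≠ z.2} =
      (Measure.pi fun _ : Fin n => D) {S | g (blockOutput g S r) z.1 ≠ z.2} *
      (Measure.pi fun _ : Fin n => D) {S | g (blockOutput g S s) z.1 ≠ z.2} := by
  have hind := (iIndepFun_pi (μ := fun _ : Fin n => D) (X := fun _ z => z)
    fun _ => aemeasurable_id).indepFun_finset (block n r) (block n s) (disjoint_block hrs)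
    fun i => measurable_pi_apply i
  have hm : ∀ I : Finset (Fin n), MeasurableSet
      {S : I → X × Bool | g (firstConsistent g S) z.1 ≠ z.2} := fun I =>
    (measurable_firstConsistent hgm) (MeasurableSet.of_discrete (s := {j | g j z.1 ≠ z.2}))
  exact hind.measure_inter_preimage_eq_mul _ _ (hm _) (hm _)

theorem expectedRisk_majorityLearner_le {H : Set (X → Bool)} {d : ℕ} (hd : HasVCDim H d)
    {g : ℕ → X → Bool} (hg : ∀ j, g j ∈ H) (hgm : ∀ j, Measurable (g j))
    (hdense : ∀ h ∈ H, ∀ s : Finset X, ∃ j, ∀ x ∈ s, g j x = h x) (D : Measure (X × Bool))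
    [IsProbabilityMeasure D] (hD : Realizable H D) (hn : 3 ≤ n) :
    (majorityLearner n hgm).expectedRisk D ≤ ENNReal.ofReal (23040 * d / n) := by
  set μ := Measure.pi fun _ : Fin n => D with hμ
  have ha := measurable_blockOutput (n := n) hgm
  set P : Fin 3 → X × Bool → ℝ≥0∞ := fun r z => μ {S | g (blockOutput g S r) z.1 ≠ z.2} with hP
  have hPm : ∀ r, Measurable (P r) := fun r => measurable_measure_prodMk_right
    (measurableSet_pi_error hgm ((measurable_pi_apply r).comp ha))
  have hsq : ∀ r, ∫⁻ z, P r z ^ 2 ∂D ≤ ENNReal.ofReal (3840 * d / n) := by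
    intro r
    have hc := div_three_le_card_block n r
    have h1 := lintegral_error_sq_le (ι := block n r) hd hg hgm D
      (measurable_firstConsistent hgm) (ae_firstConsistent hdense hD)
      (by rw [Fintype.card_coe]; omega)
    have h2 : ∀ z : X × Bool, P r z = (Measure.pi fun _ : block n r => D)
        {S | g (firstConsistent g S) z.1 ≠ z.2} := fun z => by
      have hm : MeasurableSet {S : block n r → X × Bool | g (firstConsistent g S) z.1 ≠ z.2} :=
        (measurable_firstConsistent hgm) (MeasurableSet.of_discrete (s := {j | g j z.1 ≠ z.2}))
      exact (measurePreserving_restrict_finset D (block n r)).measure_preimage hm.nullMeasurableSet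
    simp_rw [h2]
    refine h1.trans (ENNReal.ofReal_le_ofReal ?_)
    rw [Fintype.card_coe]
    -- The bound `n / 3` on block sizes is rounded down; given `3 ≤ n`, the worst ratio is at `n =
    -- 5`.
    have h3 : (n : ℝ) ≤ 5 * (block n r).card := by
      have : n ≤ 5 * (block n r).card := by omega
      exact_mod_cast this
    have hn0 : (0 : ℝ) < n := by exact_mod_cast (by omega : 0 < n)
    have hc0 : (0 : ℝ) < (block n r).card := by linarith
    rw [div_le_div_iff₀ hc0 hn0]
    have hd0 : (0 : ℝ) ≤ d := by positivity
    nlinarith [mul_le_mul_of_nonneg_left h3 hd0]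
  have hmaj : MeasurableSet {p : (Fin n → X × Bool) × (X × Bool) |
      majority g (blockOutput g p.1) p.2.1 ≠ p.2.2} :=
    (measurableSet_eq_fun ((measurable_majority hgm).comp ((ha.comp measurable_fst).prodMk
      (measurable_fst.comp measurable_snd))) (measurable_snd.comp measurable_snd)).compl
  have hpt : ∀ z : X × Bool, μ {S | majority g (blockOutput g S) z.1 ≠ z.2} ≤
      2 * (P 0 z ^ 2 + P 1 z ^ 2 + P 2 z ^ 2) := by
    intro z
    have hmul : ∀ a b : ℝ≥0∞, a * b ≤ a ^ 2 + b ^ 2 := fun a b => by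
      rcases le_total a b with h | h
      · calc a * b ≤ b * b := by gcongr
          _ ≤ a ^ 2 + b ^ 2 := by rw [← sq]; exact le_add_self
      · calc a * b ≤ a * a := by gcongr
          _ ≤ a ^ 2 + b ^ 2 := by rw [← sq]; exact le_self_add
    have hpair : ∀ r s : Fin 3, r ≠ s → μ {S | g (blockOutput g S r) z.1 ≠ z.2 ∧
        g (blockOutput g S s) z.1 ≠ z.2} ≤ P r z ^ 2 + P s z ^ 2 := fun r s hrs => by
      rw [hμ, blockOutput_error_inter hgm D z hrs]
      exact hmul _ _
    calc μ {S | majority g (blockOutput g S) z.1 ≠ z.2}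
        ≤ μ ({S | g (blockOutput g S 0) z.1 ≠ z.2 ∧ g (blockOutput g S 1) z.1 ≠ z.2} ∪
            ({S | g (blockOutput g S 0) z.1 ≠ z.2 ∧ g (blockOutput g S 2) z.1 ≠ z.2} ∪
            {S | g (blockOutput g S 1) z.1 ≠ z.2 ∧ g (blockOutput g S 2) z.1 ≠ z.2})) :=
          measure_mono fun S hS => majority_error hS
      _ ≤ (P 0 z ^ 2 + P 1 z ^ 2) + ((P 0 z ^ 2 + P 2 z ^ 2) + (P 1 z ^ 2 + P 2 z ^ 2)) := by
          refine (measure_union_le _ _).trans (add_le_add (hpair 0 1 (by decide)) ?_)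
          exact (measure_union_le _ _).trans
            (add_le_add (hpair 0 2 (by decide)) (hpair 1 2 (by decide)))
      _ = 2 * (P 0 z ^ 2 + P 1 z ^ 2 + P 2 z ^ 2) := by ring
  calc (majorityLearner n hgm).expectedRisk D
      = (μ.prod D) {p | majority g (blockOutput g p.1) p.2.1 ≠ p.2.2} :=
        Learner.expectedRisk_ofFun D
    _ = ∫⁻ z, μ {S | majority g (blockOutput g S) z.1 ≠ z.2} ∂D :=
        Measure.prod_apply_symm hmaj
    _ ≤ ∫⁻ z, 2 * (P 0 z ^ 2 + P 1 z ^ 2 + P 2 z ^ 2) ∂D := lintegral_mono hpt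
    _ = 2 * (∫⁻ z, P 0 z ^ 2 ∂D + ∫⁻ z, P 1 z ^ 2 ∂D + ∫⁻ z, P 2 z ^ 2 ∂D) := by
        have h : ∀ r, Measurable fun z => P r z ^ 2 := fun r => (hPm r).pow_const 2
        have h01 : Measurable fun z => P 0 z ^ 2 + P 1 z ^ 2 := (h 0).add (h 1)
        have h012 : Measurable fun z => P 0 z ^ 2 + P 1 z ^ 2 + P 2 z ^ 2 := h01.add (h 2)
        rw [lintegral_const_mul _ h012, lintegral_add_left h01, lintegral_add_left (h 0)]
    _ ≤ 2 * (ENNReal.ofReal (3840 * d / n) + ENNReal.ofReal (3840 * d / n) +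
          ENNReal.ofReal (3840 * d / n)) := by
        gcongr <;> exact hsq _
    _ = ENNReal.ofReal (23040 * d / n) := by
        rw [← ENNReal.ofReal_add (by positivity) (by positivity),
          ← ENNReal.ofReal_add (by positivity) (by positivity),
          ← ENNReal.ofReal_ofNat 2, ← ENNReal.ofReal_mul (by positivity)]
        congr 1; ring

end MajorityRisk

/-! ### Minimax lower bound from rare points with random labels. -/

section LowerBound

variable {X : Type u} [MeasurableSpace X] {n m : ℕ}

/-- The labelling `f` of the points `x 1, …, x m`, with the label `b` at the point `x 0`. -/
def labelledPoint (x : Fin (m + 1) → X) (b : Bool) (f : Fin m → Bool) (i : Fin (m + 1)) :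
    X × Bool :=
  (x i, Fin.cons (α := fun _ => Bool) b f i)

/-- The law on `{0, …, m}` with mass `v` at each of `1, …, m` and the remaining mass at `0`. -/
noncomputable def rareLaw (m : ℕ) (v : ℝ) : Measure (Fin (m + 1)) :=
  ENNReal.ofReal (1 - m * v) • Measure.dirac 0 +
    ∑ j : Fin m, ENNReal.ofReal v • Measure.dirac j.succ

theorem isProbabilityMeasure_rareLaw {v : ℝ} (hv : 0 ≤ v) (hmv : m * v ≤ 1) :
    IsProbabilityMeasure (rareLaw m v) := by
  constructor
  simp only [rareLaw, Measure.coe_add, Measure.coe_smul, Pi.add_apply, Pi.smul_apply,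
    Measure.dirac_apply_of_mem, Set.mem_univ, smul_eq_mul, mul_one, Measure.coe_finsetSum,
    Finset.sum_apply, Finset.sum_const, Finset.card_univ, Fintype.card_fin, nsmul_eq_mul]
  rw [← ENNReal.ofReal_natCast, ← ENNReal.ofReal_mul (by positivity),
    ← ENNReal.ofReal_add (by linarith) (by positivity)]
  simp

theorem rareLaw_compl_singleton (v : ℝ) (hv : 0 ≤ v) (hmv : m * v ≤ 1) (j : Fin m) :
    rareLaw m v {j.succ}ᶜ = ENNReal.ofReal (1 - v) := by
  have := isProbabilityMeasure_rareLaw hv hmv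
  have h1 : rareLaw m v {j.succ} = ENNReal.ofReal v := by
    simp [rareLaw, Measure.coe_finsetSum, Set.indicator_apply, (Fin.succ_ne_zero _).symm]
  rw [prob_compl_eq_one_sub (measurableSet_singleton _), h1, ENNReal.ofReal_sub _ hv,
    ENNReal.ofReal_one]

/-- Bernoulli's inequality: `(1 - v)^n ≥ 1 - n v`. -/
theorem half_le_pi_rareLaw {v : ℝ} (hv : 0 ≤ v) (hmv : m * v ≤ 1) (hnv : n * v ≤ 1 / 2)
    (hv1 : v ≤ 1) (j : Fin m) :
    ENNReal.ofReal (1 / 2) ≤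
      (Measure.pi fun _ : Fin n => rareLaw m v) {J | ∀ i, J i ≠ j.succ} := by
  have := isProbabilityMeasure_rareLaw hv hmv
  have h1 : {J : Fin n → Fin (m + 1) | ∀ i, J i ≠ j.succ} =
      Set.univ.pi fun _ => {j.succ}ᶜ := by
    ext J; simp
  rw [h1, Measure.pi_pi]
  simp only [rareLaw_compl_singleton v hv hmv, Finset.prod_const, Finset.card_univ,
    Fintype.card_fin]
  rw [← ENNReal.ofReal_pow (by linarith)]
  refine ENNReal.ofReal_le_ofReal ?_
  have := one_add_mul_le_pow (a := -v) (by linarith) n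
  rw [← sub_eq_add_neg] at this
  linarith

theorem measurableSet_predict_ne (A : Learner X n) (z : X × Bool) :
    MeasurableSet {θ | A.predict θ z.1 ≠ z.2} :=
  (measurableSet_eq_fun (A.measurable_predict.comp measurable_prodMk_right)
    measurable_const).compl

theorem measurableSet_predict_error (A : Learner X n) :
    MeasurableSet {q : A.Θ × (X × Bool) | A.predict q.1 q.2.1 ≠ q.2.2} :=
  (measurableSet_eq_fun (A.measurable_predict.comp (measurable_fst.prodMk
    (measurable_fst.comp measurable_snd))) (measurable_snd.comp measurable_snd)).compl

/-- The expected risk under a law of labelled rare points. -/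
theorem expectedRisk_map_rareLaw_ge (A : Learner X n) (x : Fin (m + 1) → X) (b : Bool)
    (f : Fin m → Bool) {v : ℝ} (hv : 0 ≤ v) (hmv : m * v ≤ 1) :
    ∑ j, ENNReal.ofReal v * ∫⁻ J, A.kernel (fun i => labelledPoint x b f (J i))
        {θ | A.predict θ (x j.succ) ≠ f j} ∂(Measure.pi fun _ : Fin n => rareLaw m v) ≤
      A.expectedRisk ((rareLaw m v).map (labelledPoint x b f)) := by
  have := isProbabilityMeasure_rareLaw hv hmv
  set ψ := labelledPoint x b f with hψ
  have hψm : Measurable ψ := Measurable.of_discrete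
  have := Measure.isProbabilityMeasure_map (μ := rareLaw m v) hψm.aemeasurable
  set D := (rareLaw m v).map ψ with hD
  have hmp : MeasurePreserving (fun (J : Fin n → Fin (m + 1)) i => ψ (J i))
      (Measure.pi fun _ => rareLaw m v) (Measure.pi fun _ => D) :=
    measurePreserving_pi _ _ fun _ => ⟨hψm, rfl⟩
  have hGm : Measurable fun S => ∫⁻ θ, D {z | A.predict θ z.1 ≠ z.2} ∂(A.kernel S) :=
    (measurable_measure_prodMk_left (measurableSet_predict_error A)).lintegral_kernel
  unfold Learner.expectedRisk
  rw [← hmp.lintegral_comp hGm]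
  rw [← Finset.sum_congr rfl fun j _ => lintegral_const_mul (ENNReal.ofReal v)
    (f := fun J : Fin n → Fin (m + 1) => A.kernel (fun i => ψ (J i))
      {θ | A.predict θ (x j.succ) ≠ f j}) Measurable.of_discrete]
  rw [← lintegral_finsetSum _ fun j _ => Measurable.of_discrete]
  refine lintegral_mono fun J => ?_
  have hms : ∀ j : Fin m, MeasurableSet {θ | A.predict θ (x j.succ) ≠ f j} := fun j =>
    measurableSet_predict_ne A (x j.succ, f j)
  have hDge : ∀ θ, ∑ j, ENNReal.ofReal v *
      {θ | A.predict θ (x j.succ) ≠ f j}.indicator 1 θ ≤ D {z | A.predict θ z.1 ≠ z.2} := by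
    intro θ
    have hE : MeasurableSet {z : X × Bool | A.predict θ z.1 ≠ z.2} :=
      measurable_prodMk_left (measurableSet_predict_error A)
    rw [hD, Measure.map_apply hψm hE]
    simp only [rareLaw, Measure.coe_add, Measure.coe_smul, Pi.add_apply, Pi.smul_apply,
      smul_eq_mul, Measure.coe_finsetSum, Finset.sum_apply]
    refine le_add_left (Finset.sum_le_sum fun j _ => ?_)
    rw [Measure.dirac_apply' _ MeasurableSet.of_discrete]
    refine le_of_eq (congrArg _ ?_)
    simp [Set.indicator_apply, hψ, labelledPoint]
  calc ∑ j, ENNReal.ofReal v * A.kernel (fun i => ψ (J i)) {θ | A.predict θ (x j.succ) ≠ f j}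
      = ∫⁻ θ, ∑ j, ENNReal.ofReal v * {θ | A.predict θ (x j.succ) ≠ f j}.indicator 1 θ
          ∂(A.kernel fun i => ψ (J i)) := by
        rw [lintegral_finsetSum _ fun j _ => (measurable_one.indicator (hms j)).const_mul _]
        refine Finset.sum_congr rfl fun j _ => ?_
        rw [lintegral_const_mul _ (measurable_one.indicator (hms j)),
          lintegral_indicator_one (hms j)]
    _ ≤ _ := lintegral_mono hDge

/-- A label that is not seen in the sample is guessed wrong on average over its two values. -/
theorem two_pow_le_sum_flip (A : Learner X n) (x : Fin (m + 1) → X) (b : Bool) (j : Fin m)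
    (J : Fin n → Fin (m + 1)) (hJ : ∀ i, J i ≠ j.succ) :
    (2 : ℝ≥0∞) ^ m ≤ 2 * ∑ f : Fin m → Bool, A.kernel (fun i => labelledPoint x b f (J i))
        {θ | A.predict θ (x j.succ) ≠ f j} := by
  set flip : (Fin m → Bool) → Fin m → Bool := fun f => Function.update f j (!f j) with hflip
  have hinv : Function.Involutive flip := fun f => by simp [hflip]
  have hsame : ∀ f i, labelledPoint x b (flip f) (J i) = labelledPoint x b f (J i) := by
    intro f i
    have := hJ i
    unfold labelledPoint
    congr 1
    generalize J i = k at this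
    refine Fin.cases (fun _ => rfl) (fun k hk => ?_) k this
    have hkj : k ≠ j := fun h => hk (h ▸ rfl)
    simp [hflip, hkj]
  rw [two_mul]
  -- Pairs each labelling with its flip at `j`: the sample is the same for both, and the two error
  -- events are complementary.
  nth_rewrite 2 [← Equiv.sum_comp (hinv.toPerm flip)]
  rw [← Finset.sum_add_distrib]
  have hone : ∀ f : Fin m → Bool, A.kernel (fun i => labelledPoint x b f (J i))
      {θ | A.predict θ (x j.succ) ≠ f j} +
      A.kernel (fun i => labelledPoint x b (hinv.toPerm flip f) (J i))
        {θ | A.predict θ (x j.succ) ≠ hinv.toPerm flip f j} = 1 := by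
    intro f
    simp only [Function.Involutive.coe_toPerm, hsame]
    have : {θ | A.predict θ (x j.succ) ≠ flip f j} =
        {θ | A.predict θ (x j.succ) ≠ f j}ᶜ := by
      ext θ
      simp only [hflip, Function.update_self, Set.mem_ofPred_eq, Set.mem_compl_iff]
      cases A.predict θ (x j.succ) <;> cases f j <;> simp
    rw [this, measure_add_measure_compl (measurableSet_predict_ne A (x j.succ, f j))]
    exact measure_univ
  rw [Finset.sum_congr rfl fun f _ => hone f]
  simp

/-- Averaging over all labellings `f`, each rare point is unseen with probability at least `1/2` and
is then misclassified half of the time, so it costs `v / 4`. The point `x 0` only absorbs the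
remaining mass, and its label is fixed. -/
theorem minimaxRisk_ge {H : Set (X → Bool)} (hm : ∀ h ∈ H, Measurable h)
    (x : Fin (m + 1) → X) (b : Bool)
    (hH : ∀ f : Fin m → Bool, ∃ h ∈ H, h (x 0) = b ∧ ∀ j : Fin m, h (x j.succ) = f j) {v : ℝ}
    (hv : 0 ≤ v) (hv1 : v ≤ 1) (hmv : m * v ≤ 1) (hnv : n * v ≤ 1 / 2) :
    ENNReal.ofReal (m * v / 4) ≤ minimaxRisk H n := by
  refine le_iInf fun A => ?_
  have := isProbabilityMeasure_rareLaw hv hmv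
  have hworst : ∀ f : Fin m → Bool,
      A.expectedRisk ((rareLaw m v).map (labelledPoint x b f)) ≤ A.worstRisk H := by
    intro f
    have hψm : Measurable (labelledPoint x b f) := Measurable.of_discrete
    refine le_iSup_of_le ((rareLaw m v).map (labelledPoint x b f)) (le_iSup_of_le
      (Measure.isProbabilityMeasure_map hψm.aemeasurable) (le_iSup_of_le ?_ le_rfl))
    obtain ⟨h, hh, h0, hj⟩ := hH f
    refine ⟨h, hh, ?_⟩
    have hms : MeasurableSet {z : X × Bool | h z.1 = z.2} :=
      measurableSet_eq_fun ((hm h hh).comp measurable_fst) measurable_snd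
    refine (ae_map_iff hψm.aemeasurable hms).2 (Filter.Eventually.of_forall fun i => ?_)
    refine Fin.cases ?_ (fun k => ?_) i
    · exact h0
    · exact hj k
  set μ := Measure.pi fun _ : Fin n => rareLaw m v
  set K : (Fin m → Bool) → Fin m → (Fin n → Fin (m + 1)) → ℝ≥0∞ := fun f j J =>
    A.kernel (fun i => labelledPoint x b f (J i)) {θ | A.predict θ (x j.succ) ≠ f j} with hK
  have hj : ∀ j : Fin m, 2 ^ m * ENNReal.ofReal (1 / 2) ≤ 2 * ∑ f, ∫⁻ J, K f j J ∂μ := by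
    intro j
    rw [← lintegral_finsetSum _ fun f _ => Measurable.of_discrete,
      ← lintegral_const_mul _ Measurable.of_discrete]
    have hms : MeasurableSet {J : Fin n → Fin (m + 1) | ∀ i, J i ≠ j.succ} :=
      MeasurableSet.of_discrete
    calc 2 ^ m * ENNReal.ofReal (1 / 2) ≤ 2 ^ m * μ {J | ∀ i, J i ≠ j.succ} := by
          gcongr; exact half_le_pi_rareLaw hv hmv hnv hv1 j
      _ = ∫⁻ J, {J : Fin n → Fin (m + 1) | ∀ i, J i ≠ j.succ}.indicator (fun _ => 2 ^ m) J ∂μ := by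
          rw [lintegral_indicator hms, setLIntegral_const]
      _ ≤ _ := by
          refine lintegral_mono fun J => ?_
          by_cases h : ∀ i, J i ≠ j.succ
          · rw [Set.indicator_of_mem (show J ∈ {J : Fin n → Fin (m + 1) | ∀ i, J i ≠ j.succ}
              from h)]
            exact two_pow_le_sum_flip A x b j J h
          · rw [Set.indicator_of_notMem (show J ∉ {J : Fin n → Fin (m + 1) | ∀ i, J i ≠ j.succ}
              from h)]
            exact zero_le
  have htot : (2 : ℝ≥0∞) ^ m * (m * (ENNReal.ofReal v * ENNReal.ofReal (1 / 2))) ≤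
      2 ^ m * (2 * A.worstRisk H) := by
    calc (2 : ℝ≥0∞) ^ m * (m * (ENNReal.ofReal v * ENNReal.ofReal (1 / 2)))
        = ∑ _j : Fin m, ENNReal.ofReal v * (2 ^ m * ENNReal.ofReal (1 / 2)) := by
          simp; ring
      _ ≤ ∑ j, ENNReal.ofReal v * (2 * ∑ f, ∫⁻ J, K f j J ∂μ) := by
          exact Finset.sum_le_sum fun j _ => mul_le_mul_right (hj j) _
      _ = 2 * ∑ f, ∑ j, ENNReal.ofReal v * ∫⁻ J, K f j J ∂μ := by
          rw [Finset.sum_comm, Finset.mul_sum]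
          refine Finset.sum_congr rfl fun j _ => ?_
          rw [← Finset.mul_sum]; ring
      _ ≤ 2 * ∑ _f : Fin m → Bool, A.worstRisk H := by
          gcongr with f
          exact (expectedRisk_map_rareLaw_ge A x b f hv hmv).trans (hworst f)
      _ = 2 ^ m * (2 * A.worstRisk H) := by
          simp; ring
  rw [ENNReal.mul_le_mul_iff_right (by positivity) (by finiteness)] at htot
  have h4 : (m : ℝ≥0∞) * (ENNReal.ofReal v * ENNReal.ofReal (1 / 2)) =
      2 * ENNReal.ofReal (m * v / 4) := by
    rw [← ENNReal.ofReal_natCast, ← ENNReal.ofReal_mul (by positivity),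
      ← ENNReal.ofReal_mul (by positivity), ← ENNReal.ofReal_ofNat 2,
      ← ENNReal.ofReal_mul (by positivity)]
    congr 1; ring
  rwa [h4, ENNReal.mul_le_mul_iff_right (by norm_num) (by norm_num)] at htot

end LowerBound

/-! ### Thresholds: exchangeability of the least positive example. -/

section Thresholds

variable {n : ℕ}

theorem measurePreserving_comp_perm {ι Z : Type*} [Fintype ι] [MeasurableSpace Z] (D : Measure Z)
    [IsProbabilityMeasure D] (e : Equiv.Perm ι) :
    MeasurePreserving (fun (z : ι → Z) i => z (e i)) (Measure.pi fun _ : ι => D)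
      (Measure.pi fun _ : ι => D) :=
  measurePreserving_arrowCongr' (fun _ : ι => D) (fun _ : ι => D) e.symm (MeasurableEquiv.refl Z)
    fun _ => MeasurePreserving.id D

/-- The points whose `k`-th entry has the strictly smallest score. -/
def strictMinAt {ι Z : Type*} (τ : Z → EReal) (k : ι) : Set (ι → Z) :=
  {z | ∀ j, j ≠ k → τ (z k) < τ (z j)}

theorem measurableSet_strictMinAt {ι Z : Type*} [Countable ι] [MeasurableSpace Z] {τ : Z → EReal}
    (hτ : Measurable τ) (k : ι) : MeasurableSet (strictMinAt τ k) := by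
  unfold strictMinAt
  simp_rw [Set.ofPred_forall]
  exact MeasurableSet.iInter fun j => MeasurableSet.iInter fun _ =>
    measurableSet_lt (hτ.comp (measurable_pi_apply k)) (hτ.comp (measurable_pi_apply j))

/-- By exchangeability the `n + 1` events are equally likely, and they are pairwise disjoint. Ties
only lose mass, hence an inequality. -/
theorem pi_strictMinAt_le {Z : Type*} [MeasurableSpace Z] (D : Measure Z)
    [IsProbabilityMeasure D] {τ : Z → EReal} (hτ : Measurable τ) (k : Fin (n + 1)) :
    (Measure.pi fun _ : Fin (n + 1) => D) (strictMinAt τ k) ≤ ENNReal.ofReal (1 / (n + 1)) := by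
  set μ := Measure.pi fun _ : Fin (n + 1) => D
  have heq : ∀ j, μ (strictMinAt τ j) = μ (strictMinAt τ k) := by
    intro j
    rw [← (measurePreserving_comp_perm D (Equiv.swap j k)).measure_preimage
      (measurableSet_strictMinAt hτ k).nullMeasurableSet]
    congr 1
    ext z
    simp only [strictMinAt, Set.mem_preimage, Set.mem_ofPred_eq, Equiv.swap_apply_right]
    constructor
    · intro h i hi
      refine h _ fun hij => hi ?_
      rw [Equiv.swap_apply_eq_iff] at hij
      rw [hij, Equiv.swap_apply_left]
    · intro h i hi
      have := h (Equiv.swap j k i) fun hij => hi (by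
        rw [Equiv.swap_apply_eq_iff] at hij
        rw [hij, Equiv.swap_apply_right])
      simpa using this
  have hdisj : Pairwise (Function.onFun Disjoint fun j : Fin (n + 1) => strictMinAt τ j) := by
    intro i j hij
    refine Set.disjoint_left.2 fun z hi hj => ?_
    exact lt_asymm (hi j hij.symm) (hj i hij)
  have hsum : ∑ j : Fin (n + 1), μ (strictMinAt τ j) ≤ 1 := by
    rw [← tsum_fintype (L := .unconditional _),
      ← measure_iUnion hdisj fun j => measurableSet_strictMinAt hτ j]
    exact prob_le_one
  simp only [heq, Finset.sum_const, Finset.card_univ, Fintype.card_fin, nsmul_eq_mul] at hsum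
  have h2 := ENNReal.toReal_mono ENNReal.one_ne_top hsum
  rw [ENNReal.toReal_mul, ENNReal.toReal_natCast, ENNReal.toReal_one] at h2
  refine ENNReal.le_ofReal_iff_toReal_le (measure_ne_top _ _) (by positivity) |>.2 ?_
  rw [le_div_iff₀ (by positivity)]
  push_cast at h2
  linarith

/-- The position of a positive example, or `⊤` for a negative example. -/
noncomputable def positivePoint (z : ℝ × Bool) : EReal := if z.2 then (z.1 : EReal) else ⊤

theorem measurable_positivePoint : Measurable positivePoint :=
  Measurable.ite (measurable_snd (measurableSet_singleton true))
    (measurable_coe_real_ereal.comp measurable_fst) measurable_const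

/-- The smallest positive example of the sample. -/
noncomputable def leastPositive (S : Fin n → ℝ × Bool) : EReal := ⨅ i, positivePoint (S i)

theorem measurable_leastPositive : Measurable (leastPositive (n := n)) :=
  Measurable.iInf fun i => measurable_positivePoint.comp (measurable_pi_apply i)

theorem measurable_predict_leastPositive :
    Measurable (Function.uncurry fun (a : EReal) (x : ℝ) => decide (a ≤ (x : EReal))) := by
  refine measurable_to_bool ?_
  have : (Function.uncurry fun (a : EReal) (x : ℝ) => decide (a ≤ (x : EReal))) ⁻¹' {true} =
      {p : EReal × ℝ | p.1 ≤ (p.2 : EReal)} := by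
    ext p; simp [Function.uncurry]
  rw [this]
  exact measurableSet_le measurable_fst (measurable_coe_real_ereal.comp measurable_snd)

/-- The learner that predicts with the threshold at the smallest positive example. -/
noncomputable def leastPositiveLearner (n : ℕ) : Learner ℝ n :=
  Learner.ofFun (fun (a : EReal) (x : ℝ) => decide (a ≤ (x : EReal)))
    measurable_predict_leastPositive leastPositive measurable_leastPositive

/-- The learned threshold is never below the true one, so only a positive held-out point can be
misclassified, and only if it lies strictly below all positive training points. -/
theorem expectedRisk_leastPositiveLearner_le (hn : 0 < n) (D : Measure (ℝ × Bool))
    [IsProbabilityMeasure D] (hD : Realizable thresholds D) :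
    (leastPositiveLearner n).expectedRisk D ≤ ENNReal.ofReal (1 / (n + 1)) := by
  obtain ⟨_, ⟨a, rfl⟩, hae⟩ := hD
  have hmp := measurePreserving_tail_head (n := n) D
  have hE : MeasurableSet {p : (Fin n → ℝ × Bool) × (ℝ × Bool) |
      decide (leastPositive p.1 ≤ (p.2.1 : EReal)) ≠ p.2.2} :=
    (measurableSet_eq_fun (measurable_predict_leastPositive.comp
      ((measurable_leastPositive.comp measurable_fst).prodMk
        (measurable_fst.comp measurable_snd))) (measurable_snd.comp measurable_snd)).compl
  have h1 : (leastPositiveLearner n).expectedRisk D =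
      (Measure.pi fun _ : Fin (n + 1) => D)
        {z | decide (leastPositive (fun i => z i.succ) ≤ ((z 0).1 : EReal)) ≠ (z 0).2} :=
    (Learner.expectedRisk_ofFun D).trans (hmp.measure_preimage hE.nullMeasurableSet).symm
  have hall : ∀ᵐ z ∂(Measure.pi fun _ : Fin (n + 1) => D), ∀ i,
      decide (a ≤ (z i).1) = (z i).2 := ae_all_iff.2 fun i =>
    (measurePreserving_eval (fun _ : Fin (n + 1) => D) i).quasiMeasurePreserving.ae hae
  rw [h1]
  refine (measure_mono_ae ?_).trans (pi_strictMinAt_le D measurable_positivePoint 0)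
  filter_upwards [hall] with z hz hne
  change decide (leastPositive (fun i => z i.succ) ≤ ((z 0).1 : EReal)) ≠ (z 0).2 at hne
  have h0 : (z 0).2 = true := by
    by_contra h0
    have h0' : (z 0).2 = false := by simpa using h0
    rw [h0'] at hne
    have hle : leastPositive (fun i => z i.succ) ≤ ((z 0).1 : EReal) := by simpa using hne
    have : Nonempty (Fin n) := ⟨⟨0, hn⟩⟩
    obtain ⟨i, hi⟩ := exists_eq_ciInf_of_finite (f := fun i : Fin n => positivePoint (z i.succ))
    have hle' : positivePoint (z i.succ) ≤ ((z 0).1 : EReal) := hi.trans_le hle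
    have hpos : (z i.succ).2 = true := by
      by_contra hc
      simp only [positivePoint, hc] at hle'
      exact absurd hle' (by simp)
    simp only [positivePoint, hpos, if_true, EReal.coe_le_coe_iff] at hle'
    have hi1 := hz i.succ
    have hi0 := hz 0
    rw [hpos, decide_eq_true_eq] at hi1
    rw [h0', decide_eq_false_iff_not] at hi0
    exact hi0 (hi1.trans hle')
  rw [h0] at hne
  have hlt : ((z 0).1 : EReal) < leastPositive (fun i => z i.succ) := by simpa using hne
  intro j hj
  obtain ⟨i, rfl⟩ := Fin.exists_succ_eq.2 hj
  have hp0 : positivePoint (z 0) = ((z 0).1 : EReal) := by simp [positivePoint, h0]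
  rw [hp0]
  exact hlt.trans_le (iInf_le (fun i : Fin n => positivePoint (z i.succ)) i)

/-- Exchanging the held-out point with a training point changes the smallest positive example
only if one of the two is the strict minimum. -/
theorem leastPositive_swap_eq {z : Fin (n + 1) → ℝ × Bool} {j : Fin (n + 1)}
    (h0 : z ∉ strictMinAt positivePoint 0) (hj : z ∉ strictMinAt positivePoint j) :
    leastPositive (fun i : Fin n => z (Equiv.swap 0 j i.succ)) =
      leastPositive (fun i : Fin n => z i.succ) := by
  have hle0 : ∀ k ≠ 0, leastPositive (fun i : Fin n => z i.succ) ≤ positivePoint (z k) := by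
    intro k hk
    obtain ⟨i, rfl⟩ := Fin.exists_succ_eq.2 hk
    exact iInf_le (fun i : Fin n => positivePoint (z i.succ)) i
  have hlej : ∀ k ≠ j, leastPositive (fun i : Fin n => z (Equiv.swap 0 j i.succ)) ≤
      positivePoint (z k) := by
    intro k hk
    have hne : Equiv.swap 0 j k ≠ 0 := fun h => hk (by
      rw [Equiv.swap_apply_eq_iff] at h
      rw [h, Equiv.swap_apply_left])
    obtain ⟨i, hi⟩ := Fin.exists_succ_eq.2 hne
    refine (iInf_le (fun i : Fin n => positivePoint (z (Equiv.swap 0 j i.succ))) i).trans ?_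
    rw [hi, Equiv.swap_apply_self]
  -- Leaving out a point that is not the strict minimum does not change the minimum over all `n + 1`
  -- points; the same holds for `j` below.
  have hall0 : ∀ k, leastPositive (fun i : Fin n => z i.succ) ≤ positivePoint (z k) := by
    intro k
    by_cases hk : k = 0
    · simp only [strictMinAt, Set.mem_ofPred_eq, not_forall, not_lt] at h0
      obtain ⟨l, hl, hle⟩ := h0
      rw [hk]; exact (hle0 l hl).trans hle
    · exact hle0 k hk
  have hallj : ∀ k, leastPositive (fun i : Fin n => z (Equiv.swap 0 j i.succ)) ≤
      positivePoint (z k) := by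
    intro k
    by_cases hk : k = j
    · simp only [strictMinAt, Set.mem_ofPred_eq, not_forall, not_lt] at hj
      obtain ⟨l, hl, hle⟩ := hj
      rw [hk]; exact (hlej l hl).trans hle
    · exact hlej k hk
  exact le_antisymm (le_iInf fun i => hallj _) (le_iInf fun i => hall0 _)

theorem leastPositiveLearner_recall_le {ξ : ℝ} (hξ : 0 ≤ ξ) {m : ℕ}
    (h : (leastPositiveLearner n).IsTraceable ξ m) : (m : ℝ) ≤ n * ξ + 2 := by
  obtain ⟨Q, D, hQ, hD, h1, h2⟩ := h.exists_of_ofFun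
  set μ := Measure.pi fun _ : Fin (n + 1) => D
  have htail : Measurable fun (z : Fin (n + 1) → ℝ × Bool) (i : Fin n) => z i.succ :=
    measurable_pi_lambda _ fun i => measurable_pi_apply i.succ
  have hj : ∀ j : Fin (n + 1), μ {z | (leastPositive fun i => z i.succ, z j) ∈ Q} ≤
      ENNReal.ofReal (ξ + 2 / (n + 1)) := by
    intro j
    have hm : MeasurableSet {z : Fin (n + 1) → ℝ × Bool |
        (leastPositive fun i => z i.succ, z 0) ∈ Q} :=
      ((measurable_leastPositive.comp htail).prodMk (measurable_pi_apply 0)) hQ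
    have hsw := (measurePreserving_comp_perm D (Equiv.swap 0 j)).measure_preimage
      hm.nullMeasurableSet
    calc μ {z | (leastPositive fun i => z i.succ, z j) ∈ Q}
        ≤ μ ((fun (z : Fin (n + 1) → ℝ × Bool) i => z (Equiv.swap 0 j i)) ⁻¹'
            {z | (leastPositive fun i => z i.succ, z 0) ∈ Q} ∪
            (strictMinAt positivePoint 0 ∪ strictMinAt positivePoint j)) := by
          refine measure_mono fun z hz => ?_
          by_cases h0 : z ∈ strictMinAt positivePoint 0
          · exact Or.inr (Or.inl h0)
          by_cases hj : z ∈ strictMinAt positivePoint j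
          · exact Or.inr (Or.inr hj)
          refine Or.inl ?_
          change (leastPositive fun i : Fin n => z (Equiv.swap 0 j i.succ),
            z (Equiv.swap 0 j 0)) ∈ Q
          rw [leastPositive_swap_eq h0 hj, Equiv.swap_apply_left]
          exact hz
      _ ≤ ENNReal.ofReal ξ + (ENNReal.ofReal (1 / (n + 1)) + ENNReal.ofReal (1 / (n + 1))) := by
          refine (measure_union_le _ _).trans (add_le_add (hsw.trans_le h1) ?_)
          exact (measure_union_le _ _).trans (add_le_add
            (pi_strictMinAt_le D measurable_positivePoint 0)
            (pi_strictMinAt_le D measurable_positivePoint j))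
      _ = ENNReal.ofReal (ξ + 2 / (n + 1)) := by
          rw [← ENNReal.ofReal_add (by positivity) (by positivity),
            ← ENNReal.ofReal_add hξ (by positivity)]
          congr 1; ring
  have h3 := h2.trans (Finset.sum_le_sum fun i _ => hj i.succ)
  simp only [Finset.sum_const, Finset.card_univ, Fintype.card_fin, nsmul_eq_mul] at h3
  rw [← ENNReal.ofReal_natCast, ← ENNReal.ofReal_natCast,
    ← ENNReal.ofReal_mul (by positivity), ENNReal.ofReal_le_ofReal_iff (by positivity)] at h3
  have h4 : (n : ℝ) * (2 / (n + 1)) ≤ 2 := by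
    rw [mul_div_assoc', div_le_iff₀ (by positivity)]; linarith
  linarith

end Thresholds

/-! ### Sample optimality of both learners. -/

section Optimality

variable {X : Type u} [MeasurableSpace X] {n : ℕ}

/-- A class in which two concepts agree at one point and differ at another. -/
def HasAgreeDifferPair (H : Set (X → Bool)) : Prop :=
  ∃ h ∈ H, ∃ h' ∈ H, ∃ x₀ x₁, h x₀ = h' x₀ ∧ h x₁ ≠ h' x₁

/-- One rare point of mass `1 / (2 n)`: the point of agreement is the heavy one and reveals nothing
about the label at the other. VC dimension one alone would not suffice, as a concept and its
complement show. -/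
theorem minimaxRisk_ge_of_agree_differ {H : Set (X → Bool)} (hm : ∀ h ∈ H, Measurable h)
    (hH : HasAgreeDifferPair H) (hn : 0 < n) : ENNReal.ofReal (1 / (8 * n)) ≤ minimaxRisk H n := by
  obtain ⟨h, hh, h', hh', x₀, x₁, h0, h1⟩ := hH
  have hn1 : (1 : ℝ) ≤ n := by exact_mod_cast hn
  have := minimaxRisk_ge (n := n) (m := 1) hm ![x₀, x₁] (h x₀) (fun f => ?_)
    (v := 1 / (2 * n)) (by positivity) ?_ ?_ ?_
  · refine le_trans (le_of_eq ?_) this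
    congr 1; push_cast; field_simp; norm_num
  · by_cases hf : h x₁ = f 0
    · exact ⟨h, hh, rfl, fun j => by rw [Subsingleton.elim j 0]; exact hf⟩
    · refine ⟨h', hh', h0.symm, fun j => ?_⟩
      rw [Subsingleton.elim j 0]
      change h' x₁ = f 0
      revert h1 hf
      cases h x₁ <;> cases h' x₁ <;> cases f 0 <;> simp
  · rw [div_le_one (by positivity)]; linarith
  · push_cast; rw [one_mul, div_le_one (by positivity)]; linarith
  · apply le_of_eq; field_simp

theorem minimaxRisk_ge_of_hasVCDim {H : Set (X → Bool)} (hm : ∀ h ∈ H, Measurable h) {d : ℕ}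
    (hd : HasVCDim H d) (hd2 : 2 ≤ d) (hn : 0 < n) :
    ENNReal.ofReal (min ((d : ℝ) / n) 1 / 16) ≤ minimaxRisk H n := by
  classical
  obtain ⟨⟨s, hs, hsh⟩, -⟩ := hd
  obtain ⟨m, rfl⟩ : ∃ m, d = m + 1 := ⟨d - 1, by omega⟩
  set e : s ≃ Fin (m + 1) := s.equivFinOfCardEq hs
  have hn1 : (1 : ℝ) ≤ n := by exact_mod_cast hn
  have hm1 : (1 : ℝ) ≤ m := by exact_mod_cast (by omega : 1 ≤ m)
  -- The largest mass for which the `m = d - 1` rare points fit into total mass one and each is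
  -- missed with probability at least `1/2`.
  set v : ℝ := min (1 / m) (1 / (2 * n)) with hv
  have hv0 : 0 ≤ v := le_min (by positivity) (by positivity)
  have hvm : v ≤ 1 / m := min_le_left _ _
  have hvn : v ≤ 1 / (2 * n) := min_le_right _ _
  have hmv : m * v ≤ 1 := by
    rw [le_div_iff₀ (by positivity)] at hvm; linarith
  have hnv : n * v ≤ 1 / 2 := by
    rw [le_div_iff₀ (by positivity)] at hvn; linarith
  have := minimaxRisk_ge (n := n) (m := m) hm (fun i => (e.symm i : X)) false (fun f => ?_)
    (v := v) hv0 (by nlinarith) hmv hnv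
  · refine le_trans (ENNReal.ofReal_le_ofReal ?_) this
    rcases le_total (1 / (m : ℝ)) (1 / (2 * n)) with h | h
    · rw [hv, min_eq_left h, mul_one_div_cancel (by positivity)]
      linarith [min_le_right (((m + 1 : ℕ) : ℝ) / n) 1]
    · rw [hv, min_eq_right h]
      have h1 : ((m + 1 : ℕ) : ℝ) / n ≤ 4 * (m * (1 / (2 * n))) := by
        push_cast
        rw [div_le_iff₀ (by positivity)]
        field_simp
        linarith
      linarith [min_le_left (((m + 1 : ℕ) : ℝ) / n) 1]
  · obtain ⟨h, hh, hx⟩ := hsh fun x => if hx : x ∈ s then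
      Fin.cons (α := fun _ => Bool) false f (e ⟨x, hx⟩) else false
    have key : ∀ i, h (e.symm i) = Fin.cons (α := fun _ => Bool) false f i := fun i => by
      rw [hx _ (e.symm i).2]
      simp
    exact ⟨h, hh, key 0, fun j => key j.succ⟩

/-- Here a single labelled example determines the concept. The minimax risk may vanish for such
classes, so optimality requires exactly zero. -/
theorem expectedRisk_majorityLearner_eq_zero {H : Set (X → Bool)} (hH : ¬ HasAgreeDifferPair H)
    {g : ℕ → X → Bool} (hg : ∀ j, g j ∈ H) (hgm : ∀ j, Measurable (g j))
    (hdense : ∀ h ∈ H, ∀ s : Finset X, ∃ j, ∀ x ∈ s, g j x = h x) (D : Measure (X × Bool))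
    [IsProbabilityMeasure D] (hD : Realizable H D) (hn : 2 ≤ n) :
    (majorityLearner n hgm).expectedRisk D = 0 := by
  have heq : ∀ h ∈ H, ∀ h' ∈ H, ∀ x₀, h x₀ = h' x₀ → h = h' := by
    intro h hh h' hh' x₀ h0
    by_contra hne
    obtain ⟨x₁, h1⟩ := Function.ne_iff.1 hne
    exact hH ⟨h, hh, h', hh', x₀, x₁, h0, h1⟩
  have hcons : ∀ r : Fin 3, ∀ᵐ S ∂(Measure.pi fun _ : Fin n => D), ∀ i : block n r,
      g (blockOutput g S r) (S i).1 = (S i).2 := fun r =>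
    (measurePreserving_restrict_finset D (block n r)).quasiMeasurePreserving.ae
      (ae_firstConsistent hdense hD)
  obtain ⟨h, hh, hae⟩ := hD
  have hae' : ∀ᵐ S ∂(Measure.pi fun _ : Fin n => D), ∀ i, h (S i).1 = (S i).2 :=
    ae_all_iff.2 fun i =>
      (measurePreserving_eval (fun _ : Fin n => D) i).quasiMeasurePreserving.ae hae
  have hblock : ∀ r : Fin 3, r.1 < 2 → ∀ᵐ S ∂(Measure.pi fun _ : Fin n => D),
      g (blockOutput g S r) = h := by
    intro r hr
    filter_upwards [hcons r, hae'] with S h1 h2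
    -- For `n = 2` the third block is empty; the first two are nonempty and already form a majority.
    have hmem : (⟨r.1, by omega⟩ : Fin n) ∈ block n r := by
      simp only [block, Finset.mem_filter, Finset.mem_univ, true_and]
      omega
    exact heq _ (hg _) _ hh _ ((h1 ⟨_, hmem⟩).trans (h2 _).symm)
  have hall : ∀ᵐ p ∂((Measure.pi fun _ : Fin n => D).prod D),
      majority g (blockOutput g p.1) p.2.1 = p.2.2 := by
    filter_upwards [Measure.quasiMeasurePreserving_fst.ae (hblock 0 (by decide)),
      Measure.quasiMeasurePreserving_fst.ae (hblock 1 (by decide)),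
      Measure.quasiMeasurePreserving_snd.ae hae] with p h0 h1 h2
    rw [← h2]
    unfold majority
    rw [h0, h1]
    cases h p.2.1 <;> simp
  exact (Learner.expectedRisk_ofFun D).trans (ae_iff.1 hall)

theorem isSampleOptimal_majorityLearner {H : Set (X → Bool)} (hm : ∀ h ∈ H, Measurable h) {d : ℕ}
    (hd : HasVCDim H d) {g : ℕ → X → Bool} (hg : ∀ j, g j ∈ H) (hgm : ∀ j, Measurable (g j))
    (hdense : ∀ h ∈ H, ∀ s : Finset X, ∃ j, ∀ x ∈ s, g j x = h x) (hn : 2 ≤ n) :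
    (majorityLearner n hgm).IsSampleOptimal H 1000000 := by
  by_cases hH : HasAgreeDifferPair H
  swap
  · have : (majorityLearner n hgm).worstRisk H = 0 := by
      unfold Learner.worstRisk
      simp only [ENNReal.iSup_eq_zero]
      intro D hDp hD
      exact expectedRisk_majorityLearner_eq_zero hH hg hgm hdense D hD hn
    unfold Learner.IsSampleOptimal
    rw [this]
    exact zero_le
  have hn0 : (0 : ℝ) < n := by exact_mod_cast (by omega : 0 < n)
  have hd1 : 1 ≤ d := by
    obtain ⟨h, hh, h', hh', -, x₁, -, h1⟩ := hH
    refine hd.2 ⟨{x₁}, rfl, fun f => ?_⟩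
    by_cases hf : h x₁ = f x₁
    · exact ⟨h, hh, fun x hx => by rw [Finset.mem_singleton.1 hx]; exact hf⟩
    · refine ⟨h', hh', fun x hx => ?_⟩
      rw [Finset.mem_singleton.1 hx]
      revert h1 hf
      cases h x₁ <;> cases h' x₁ <;> cases f x₁ <;> simp
  have hd1' : (1 : ℝ) ≤ d := by exact_mod_cast hd1
  have hlow : ENNReal.ofReal (min ((d : ℝ) / n) 1 / 16) ≤ minimaxRisk H n := by
    rcases hd1.lt_or_eq with h | h
    · exact minimaxRisk_ge_of_hasVCDim hm hd h (by omega)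
    · refine le_trans (ENNReal.ofReal_le_ofReal ?_)
        (minimaxRisk_ge_of_agree_differ hm hH (by omega))
      rw [← h]
      have h1 := min_le_left (((1 : ℕ) : ℝ) / n) 1
      have h2 : (1 : ℝ) / (8 * n) = 1 / n / 8 := by field_simp
      have h3 : (0 : ℝ) ≤ 1 / n := by positivity
      rw [h2]
      push_cast at h1 ⊢
      linarith
  have hup : (majorityLearner n hgm).worstRisk H ≤
      ENNReal.ofReal (23040 * min ((d : ℝ) / n) 1) := by
    refine iSup_le fun D => iSup_le fun hDp => iSup_le fun hD => ?_
    have hone : (majorityLearner n hgm).expectedRisk D ≤ ENNReal.ofReal 1 := by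
      rw [ENNReal.ofReal_one]
      exact (Learner.expectedRisk_ofFun D).trans_le prob_le_one
    rcases le_total 1 ((d : ℝ) / n) with h | h
    · refine hone.trans (ENNReal.ofReal_le_ofReal ?_)
      rw [min_eq_right h]; norm_num
    rw [min_eq_left h]
    -- The risk bound requires three nonempty blocks; for `n = 2` the trivial bound 1 is enough,
    -- because `d ≥ 1`.
    rcases hn.lt_or_eq with h3 | h3
    · refine (expectedRisk_majorityLearner_le hd hg hgm hdense D hD h3).trans (le_of_eq ?_)
      rw [mul_div_assoc]
    · refine hone.trans (ENNReal.ofReal_le_ofReal ?_)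
      rw [← h3]; push_cast; linarith
  calc (majorityLearner n hgm).worstRisk H ≤ ENNReal.ofReal (23040 * min ((d : ℝ) / n) 1) := hup
    _ ≤ ENNReal.ofReal (1000000 * (min ((d : ℝ) / n) 1 / 16)) := by
        refine ENNReal.ofReal_le_ofReal ?_
        have : (0 : ℝ) ≤ min ((d : ℝ) / n) 1 := le_min (by positivity) (by norm_num)
        linarith
    _ = ENNReal.ofReal 1000000 * ENNReal.ofReal (min ((d : ℝ) / n) 1 / 16) :=
        ENNReal.ofReal_mul (by norm_num)
    _ ≤ _ := mul_le_mul_right hlow _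

theorem isSampleOptimal_leastPositiveLearner (hn : 2 ≤ n) :
    (leastPositiveLearner n).IsSampleOptimal thresholds 1000000 := by
  have hn0 : (0 : ℝ) < n := by exact_mod_cast (by omega : 0 < n)
  have hm : ∀ h ∈ thresholds, Measurable h := by
    rintro _ ⟨a, rfl⟩
    refine measurable_to_bool ?_
    have : (fun x : ℝ => decide (a ≤ x)) ⁻¹' {true} = Set.Ici a := by ext; simp
    rw [this]
    exact measurableSet_Ici
  have hlow := minimaxRisk_ge_of_agree_differ (n := n) hm
    ⟨_, ⟨0, rfl⟩, _, ⟨1, rfl⟩, 1, 0, by simp, by norm_num⟩ (by omega)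
  have hup : (leastPositiveLearner n).worstRisk thresholds ≤ ENNReal.ofReal (1 / (n + 1)) :=
    iSup_le fun D => iSup_le fun _ => iSup_le fun hD =>
      expectedRisk_leastPositiveLearner_le (by omega) D hD
  calc (leastPositiveLearner n).worstRisk thresholds ≤ ENNReal.ofReal (1 / (n + 1)) := hup
    _ ≤ ENNReal.ofReal (1000000 * (1 / (8 * n))) := by
        refine ENNReal.ofReal_le_ofReal ?_
        rw [mul_one_div, div_le_div_iff₀ (by positivity) (by positivity)]
        linarith
    _ = ENNReal.ofReal 1000000 * ENNReal.ofReal (1 / (8 * n)) :=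
        ENNReal.ofReal_mul (by norm_num)
    _ ≤ _ := mul_le_mul_right hlow _

end Optimality

/-! ### Numerical estimates and the main theorem. -/

theorem natCast_mul_div_mul_log_le {n : ℕ} (hn : 2 ≤ n) {ξ : ℝ} (hξ : 0 < ξ) (hξ1 : ξ < 1 / 10) :
    0 ≤ ξ / ((n : ℝ) * Real.log n) ∧ (n : ℝ) * (ξ / ((n : ℝ) * Real.log n)) < 1 / 5 := by
  have hn2 : (2 : ℝ) ≤ n := by exact_mod_cast hn
  have hlog : 1 / 2 < Real.log n :=
    lt_of_lt_of_le (by linarith [Real.log_two_gt_d9]) (Real.log_le_log (by norm_num) hn2)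
  refine ⟨by positivity, ?_⟩
  have : (n : ℝ) * (ξ / ((n : ℝ) * Real.log n)) = ξ / Real.log n := by
    field_simp
  rw [this, div_lt_iff₀ (by linarith)]
  linarith

theorem le_mul_log_sq_of_recall_le {n m d : ℕ} (hn : 2 ≤ n) {ε : ℝ} (hε : ε < 1 / 5)
    (h : (m : ℝ) ≤ 2 * ε + 9 * d * Real.log (2 * n + 1)) :
    (m : ℝ) ≤ 1000000 * d * Real.log n ^ 2 := by
  have hn2 : (2 : ℝ) ≤ n := by exact_mod_cast hn
  have hlog : 1 / 2 < Real.log n :=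
    lt_of_lt_of_le (by linarith [Real.log_two_gt_d9]) (Real.log_le_log (by norm_num) hn2)
  rcases Nat.eq_zero_or_pos d with rfl | hd
  · have hm : (m : ℝ) < 1 := by
      simp only [Nat.cast_zero, mul_zero, zero_mul, add_zero] at h
      linarith
    have : m = 0 := by
      have : m < 1 := by exact_mod_cast hm
      omega
    simp [this]
  · have hd1 : (1 : ℝ) ≤ d := by exact_mod_cast hd
    have h3 : Real.log (2 * n + 1) ≤ 3 * Real.log n := by
      have h9 : (4 : ℝ) ≤ n ^ 2 := by nlinarith
      have := Real.log_le_log (x := 2 * (n : ℝ) + 1) (y := (n : ℝ) ^ 3) (by positivity)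
        (by nlinarith)
      rwa [Real.log_pow] at this
    have h4 : Real.log n ≤ 2 * Real.log n ^ 2 := by nlinarith
    have h5 : 1 / 4 ≤ Real.log n ^ 2 := by nlinarith
    have h6 : (m : ℝ) ≤ 2 * Real.log n ^ 2 + 9 * d * (3 * (2 * Real.log n ^ 2)) := by
      refine h.trans (add_le_add (by linarith) ?_)
      gcongr
      linarith
    have h7 : Real.log n ^ 2 ≤ d * Real.log n ^ 2 :=
      le_mul_of_one_le_left (by positivity) hd1
    nlinarith

theorem mainTheorem10 :
    ∃ C : ℝ, 0 < C ∧
      (∀ (n : ℕ) (ξ : ℝ), 2 ≤ n → 0 < ξ → ξ < 1 / 10 →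
        ∀ (X : Type u) [MeasurableSpace X] (H : Set (X → Bool)) (d : ℕ),
          IsMeasurableClass H → HasVCDim H d →
          ∃ A : Learner X n, A.IsSampleOptimal H C ∧
            ∀ m : ℕ, A.IsTraceable (ξ / ((n : ℝ) * Real.log (n : ℝ))) m →
              (m : ℝ) ≤ C * (d : ℝ) * Real.log (n : ℝ) ^ 2) ∧
      (∀ (n : ℕ) (ξ : ℝ), 2 ≤ n → 0 < ξ → ξ < 1 / 10 →
        ∃ A : Learner ℝ n, A.IsSampleOptimal thresholds C ∧
          ∀ m : ℕ, A.IsTraceable (ξ / ((n : ℝ) * Real.log (n : ℝ))) m →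
            (m : ℝ) ≤ C) := by
  refine ⟨1000000, by norm_num, fun n ξ hn hξ hξ1 X _ H d hH hd => ?_, fun n ξ hn hξ hξ1 => ?_⟩
  · obtain ⟨H₀, hsub, hcount, hdense⟩ := hH.exists_countable_dense
    have hne : H₀.Nonempty := by
      obtain ⟨⟨s, -, hs⟩, -⟩ := hd
      obtain ⟨h, hh, -⟩ := hs fun _ => false
      obtain ⟨h₀, hh₀, -⟩ := hdense h hh ∅
      exact ⟨h₀, hh₀⟩
    -- One enumeration, possibly with repetitions, is fixed before any sample is seen; the counting
    -- of outputs depends on this.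
    obtain ⟨g, rfl⟩ := hcount.exists_eq_range hne
    have hg : ∀ j, g j ∈ H := fun j => hsub ⟨j, rfl⟩
    have hgm : ∀ j, Measurable (g j) := fun j => hH.measurable _ (hg j)
    have hdense' : ∀ h ∈ H, ∀ s : Finset X, ∃ j, ∀ x ∈ s, g j x = h x := by
      intro h hh s
      obtain ⟨_, ⟨j, rfl⟩, hj⟩ := hdense h hh s
      exact ⟨j, hj⟩
    refine ⟨majorityLearner n hgm,
      isSampleOptimal_majorityLearner hH.measurable hd hg hgm hdense' hn, fun m hm => ?_⟩
    obtain ⟨h0, h1⟩ := natCast_mul_div_mul_log_le hn hξ hξ1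
    exact le_mul_log_sq_of_recall_le hn h1 (majorityLearner_recall_le hd hg hgm h0 hm)
  · refine ⟨leastPositiveLearner n, isSampleOptimal_leastPositiveLearner hn, fun m hm => ?_⟩
    obtain ⟨h0, h1⟩ := natCast_mul_div_mul_log_le hn hξ hξ1
    linarith [leastPositiveLearner_recall_le h0 hm]
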